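/- Let $d\ge 1$ be an integer and let $\beta\ge d/2$. For $\varphi\in L^1(\mathbb{R}^d)$ (complex valued) write $\widehat\varphi(\xi)=\int_{\mathbb{R}^d}\varphi(t)e^{-2i\pi\langle t,\xi\rangle}\,dt$, and let $|\varphi|^*$ be its symmetric decreasing rearrangement, $|\varphi|^*(x)=\int_0^{\infty}\chi_{\{y:|\varphi(y)|>\lambda\}^*}(x)\,d\lambda$, where $E^*$ is the open ball centred at $0$ with $|E^*|=|E|$. For real $\gamma$ let $t_+^\gamma=t^\gamma$ if $t>0$ and $t_+^\gamma=0$ if $t\le 0$. For $\varphi\in L^1(\mathbb{R}^d)$, $|\varphi|^*$ is integrable, $\widehat{|\varphi|^*}$ is real valued, and $(1-|\xi|^2/\Omega^2)_+^\beta\,\widehat{|\varphi|^*}(\xi)$ is integrable in $\xi$ for every $\Omega>0$. Moreover: (i) For every $\alpha>-1/2$ there is a constant $C=C(d,\alpha,\beta)>0$ such that for all $S,\Omega>0$, every $\varphi\in L^1(\mathbb{R}^d)$ whose support $\{\varphi\ne0\}$ has measure $S$, and every $a\in\mathbb{R}^d$, $$\Omega^{-d}\int_{\mathbb{R}^d}|\widehat\varphi(\xi)|\,(1-|\xi-a|^2/\Omega^2)_+^\alpha\,d\xi\le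 C\,(1+\Omega^dS)^{d/2}\int_{\mathbb{R}^d}\Omega^{-d}(1-|\xi|^2/\Omega^2)_+^\beta\;\widehat{|\varphi|^*}(\xi)\,d\xi .$$ (ii) There is a constant $C=C(d,\beta)>0$ such that for every $\psi\in L^1(\mathbb{R}^d)\cap L^2(\mathbb{R}^d)$, all $S,\Omega>0$ and every $\varphi\in L^1(\mathbb{R}^d)$ whose support $\{\varphi\ne0\}$ has measure $S$, $$\int_{\mathbb{R}^d}|\widehat\varphi(\xi)|\,|\psi(\xi/\Omega)|\,d\xi\le C\bigl(\|\psi\|_1^{2/d}+\|\psi\|_2^{2/d}\bigr)^{d/2}(1+\Omega^dS)^{d/2}\int_{\mathbb{R}^d}(1-|\xi|^2/\Omega^2)_+^\beta\;\widehat{|\varphi|^*}(\xi)\,d\xi .$$ The integrals on the left-hand sides converge as well. -/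

import Mathlib

open MeasureTheory
open scoped FourierTransform ENNReal

namespace FourierRearrangement

/-- The power `t₊ ^ α` of the positive part, equal to `t ^ α` for `t > 0` and to `0` for `t ≤ 0`,
also when `α ≤ 0` (so that `(1 - |x|²)₊ ^ 0` is the indicator function of the open unit ball). -/
noncomputable def posPow (t α : ℝ) : ℝ :=
  if 0 < t then t ^ α else 0

/-- For `E ⊆ ℝᵈ` of finite measure, `E^*` is the open ball `B(0, r)` with
`|B(0, 1)| r ^ d = |E|`. -/
noncomputable def setRearrangement {d : ℕ} (E : Set (EuclideanSpace ℝ (Fin d))) :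
    Set (EuclideanSpace ℝ (Fin d)) :=
  Metric.ball 0 ((volume.real E /
    volume.real (Metric.ball (0 : EuclideanSpace ℝ (Fin d)) 1)) ^ (1 / (d : ℝ)))

/-- The symmetric decreasing rearrangement
`|φ|^*(x) = ∫_0^∞ χ_{ {y : |φ(y)| > t}^* }(x) dt`, with values in `[0, ∞]`
(it can be infinite only at the origin, when `φ` is essentially unbounded). -/
noncomputable def symmRearrangement {d : ℕ} (φ : EuclideanSpace ℝ (Fin d) → ℂ)
    (x : EuclideanSpace ℝ (Fin d)) : ℝ≥0∞ :=
  ∫⁻ t in Set.Ioi (0 : ℝ),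
    (setRearrangement {y | t < ‖φ y‖}).indicator (fun _ => (1 : ℝ≥0∞)) x

/-- The rearrangement `|φ|^*` as a complex-valued function, to which the Fourier transform
`f ↦ (ξ ↦ ∫ f(t) e^{-2iπ⟨t, ξ⟩} dt)` applies. -/
noncomputable def rearr {d : ℕ} (φ : EuclideanSpace ℝ (Fin d) → ℂ)
    (x : EuclideanSpace ℝ (Fin d)) : ℂ :=
  ((symmRearrangement φ x).toReal : ℂ)

end FourierRearrangement

namespace FourierRearrangement

open Set ProbabilityTheory

/-! ### Beta integrals of power series -/

/-! Both sides are compared, layer by layer, with `∫₀^∞ min(1, u_t) dt`, where `E_t = {|φ| > t}` and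
`u_t = Ω^d |E_t|`.

Upper bound for the left side. `φ` is the integral over `t > 0` of its phase cut off to `E_t`. For
one such layer, the integral of its transform against `|ψ(·/Ω)|` is at most `u_t ‖ψ‖₁` (sup bound on
the transform) and at most `u_t^{1/2} ‖ψ‖₂` (Cauchy-Schwarz and Plancherel). The first bound serves
for `u_t ≤ 1`, the second for `u_t ≥ 1`. Since `u_t ≤ Ω^d S`, the layer contributes at most `M (1 +
Ω^d S)^{1/2} min(1, u_t)` with `M` above both norms (`lintegral_enorm_fourier_phaseLayer_mul_le`).
The exponent `1/2` is at most `d/2`.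

Lower bound for the right side. `|φ|^*` is the integral of the indicators of the balls `E_t^*`, so
by Fubini it is enough to bound the pairing of the weight with the transform of one ball of radius
`r` below by a multiple of `min(1, (Ωr)^d)` (`exists_le_rieszBall`). This is the heart of the
matter, because the transform oscillates. For `Ω = 1` and `β = d/2` the pairing is a positive
multiple of `∫ J_d(s) ds/s` over `(0, 2πr)`, and this is an average of squares `J_{d/2}²` against a
beta density (`setIntegral_betaWeight_besselSeries_sq`). So it is positive, and keeping only small
arguments gives the quantitative bound. A larger `β` is reached by one more average against a
positive kernel (`setIntegral_betaWeight_besselIntegralSeries`).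

The Bessel identities are proved on power series integrated termwise against beta densities, and no
asymptotics of Bessel functions enter. -/

theorem integrableOn_betaWeight {a b : ℝ} (ha : 0 < a) (hb : 0 < b) :
    IntegrableOn (fun t : ℝ => t ^ (a - 1) * (1 - t) ^ (b - 1)) (Ioo 0 1) := by
  have h := Complex.betaIntegral_convergent (u := a) (v := b) (by simpa) (by simpa)
  rw [intervalIntegrable_iff_integrableOn_Ioo_of_le zero_le_one] at h
  refine IntegrableOn.congr_fun (f := fun t : ℝ => ((t : ℂ) ^ ((a : ℂ) - 1) *
    (1 - (t : ℂ)) ^ ((b : ℂ) - 1)).re) (Integrable.re h) (fun t ht => ?_) measurableSet_Ioo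
  have h1 : (0 : ℝ) ≤ 1 - t := by linarith [ht.2]
  have : ((t : ℂ) ^ ((a : ℂ) - 1) * (1 - (t : ℂ)) ^ ((b : ℂ) - 1))
      = ((t ^ (a - 1) * (1 - t) ^ (b - 1) : ℝ) : ℂ) := by
    rw [Complex.ofReal_mul, Complex.ofReal_cpow ht.1.le, Complex.ofReal_cpow h1]
    push_cast
    rfl
  simp only [this]
  exact Complex.ofReal_re _

theorem setIntegral_betaWeight {a b : ℝ} (ha : 0 < a) (hb : 0 < b) :
    ∫ t in Ioo (0 : ℝ) 1, t ^ (a - 1) * (1 - t) ^ (b - 1) = beta a b := by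
  rw [beta_eq_betaIntegralReal a b ha hb, Complex.betaIntegral,
    intervalIntegral.integral_of_le zero_le_one, integral_Ioc_eq_integral_Ioo]
  have : ∀ t ∈ Ioo (0 : ℝ) 1, ((t : ℂ) ^ ((a : ℂ) - 1) * (1 - (t : ℂ)) ^ ((b : ℂ) - 1))
      = ((t ^ (a - 1) * (1 - t) ^ (b - 1) : ℝ) : ℂ) := by
    intro t ht
    have h1 : (0 : ℝ) ≤ 1 - t := by linarith [ht.2]
    rw [Complex.ofReal_mul, Complex.ofReal_cpow ht.1.le, Complex.ofReal_cpow h1]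
    push_cast
    rfl
  rw [setIntegral_congr_fun measurableSet_Ioo this, integral_complex_ofReal, Complex.ofReal_re]

theorem betaWeight_mul_pow {a b t : ℝ} (ht : 0 < t) (n : ℕ) :
    t ^ (a - 1) * (1 - t) ^ (b - 1) * t ^ n = t ^ (a + n - 1) * (1 - t) ^ (b - 1) := by
  rw [show a + n - 1 = (a - 1) + n by ring, Real.rpow_add ht, Real.rpow_natCast]
  ring

theorem betaWeight_nonneg {a b t : ℝ} (ht : t ∈ Ioo (0 : ℝ) 1) :
    0 ≤ t ^ (a - 1) * (1 - t) ^ (b - 1) :=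
  mul_nonneg (Real.rpow_nonneg ht.1.le _) (Real.rpow_nonneg (by linarith [ht.2]) _)

/-- A power series integrated termwise against a beta density. -/
theorem hasSum_betaWeight {a b : ℝ} (ha : 0 < a) (hb : 0 < b) {c : ℕ → ℝ}
    (hc : Summable fun n => |c n|) :
    HasSum (fun n : ℕ => c n * beta (a + n) b)
      (∫ t in Ioo (0 : ℝ) 1, t ^ (a - 1) * (1 - t) ^ (b - 1) * ∑' n, c n * t ^ n) := by
  have hpos : ∀ n : ℕ, 0 < a + n := fun n => by positivity
  have hint : ∀ n : ℕ, IntegrableOn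
      (fun t : ℝ => c n * (t ^ (a + n - 1) * (1 - t) ^ (b - 1))) (Ioo 0 1) := fun n =>
    (integrableOn_betaWeight (hpos n) hb).const_mul _
  have hle : ∀ n : ℕ, beta (a + n) b ≤ beta a b := fun n => by
    rw [← setIntegral_betaWeight (hpos n) hb, ← setIntegral_betaWeight ha hb]
    refine setIntegral_mono_on (integrableOn_betaWeight (hpos n) hb)
      (integrableOn_betaWeight ha hb) measurableSet_Ioo fun t ht => ?_
    rw [← betaWeight_mul_pow ht.1]
    exact mul_le_of_le_one_right (betaWeight_nonneg ht) (pow_le_one₀ ht.1.le ht.2.le)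
  have key := hasSum_integral_of_summable_integral_norm (F := fun (n : ℕ) (t : ℝ) =>
    c n * (t ^ (a + n - 1) * (1 - t) ^ (b - 1))) (μ := volume.restrict (Ioo (0 : ℝ) 1)) hint ?_
  · have e1 : ∀ n : ℕ, ∫ t in Ioo (0 : ℝ) 1, c n * (t ^ (a + n - 1) * (1 - t) ^ (b - 1)) =
        c n * beta (a + n) b := fun n => by
      rw [integral_const_mul, setIntegral_betaWeight (hpos n) hb]
    simp only [e1] at key
    have e2 : ∫ t in Ioo (0 : ℝ) 1, t ^ (a - 1) * (1 - t) ^ (b - 1) * ∑' n, c n * t ^ n =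
        ∫ t in Ioo (0 : ℝ) 1, ∑' n : ℕ, c n * (t ^ (a + n - 1) * (1 - t) ^ (b - 1)) := by
      refine setIntegral_congr_fun measurableSet_Ioo fun t ht => ?_
      rw [← tsum_mul_left]
      refine tsum_congr fun n => ?_
      rw [← betaWeight_mul_pow ht.1]
      ring
    rwa [e2]
  · have : ∀ n : ℕ, ∫ t in Ioo (0 : ℝ) 1, ‖c n * (t ^ (a + n - 1) * (1 - t) ^ (b - 1))‖
        = |c n| * beta (a + n) b := fun n => by
      rw [← setIntegral_betaWeight (hpos n) hb, ← integral_const_mul]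
      refine setIntegral_congr_fun measurableSet_Ioo fun t ht => ?_
      simp only [Real.norm_eq_abs]
      rw [abs_mul, abs_of_nonneg (betaWeight_nonneg ht)]
    simp_rw [this]
    refine Summable.of_nonneg_of_le (fun n => ?_) (fun n => ?_) (hc.mul_right (beta a b))
    · exact mul_nonneg (abs_nonneg _) (beta_pos (hpos n) hb).le
    · exact mul_le_mul_of_nonneg_left (hle n) (abs_nonneg _)

/-! ### Vandermonde's identity with Gamma functions -/

theorem descPochhammer_eval_eq_Gamma (n : ℕ) {x : ℝ} (hx : 0 < x - n + 1) :
    (descPochhammer ℝ n).eval x = Real.Gamma (x + 1) / Real.Gamma (x - n + 1) := by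
  induction n with
  | zero =>
    have : 0 < x + 1 := by simpa using hx
    simp [(Real.Gamma_pos_of_pos this).ne']
  | succ n ih =>
    have h0 : 0 < x - n := by push_cast at hx; linarith
    rw [descPochhammer_succ_eval, ih (by linarith), Real.Gamma_add_one h0.ne',
      show x - (n + 1 : ℕ) + 1 = x - n by push_cast; ring]
    have := (Real.Gamma_pos_of_pos h0).ne'
    field_simp

theorem ringChoose_eq_Gamma (n : ℕ) {x : ℝ} (hx : 0 < x - n + 1) :
    Ring.choose x n = Real.Gamma (x + 1) / (n.factorial * Real.Gamma (x - n + 1)) := by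
  rw [Ring.choose_eq_smul, Polynomial.descPochhammer_smeval_eq_ascPochhammer,
    Polynomial.ascPochhammer_smeval_eq_eval, ← descPochhammer_eval_eq_ascPochhammer,
    descPochhammer_eval_eq_Gamma n hx, smul_eq_mul]
  field_simp

/-- Chu-Vandermonde with both upper arguments equal to `n + μ`: when `k + l = n`, the binomial `C(n
+ μ, k)` is `Γ(n + μ + 1) / (k! Γ(l + μ + 1))`, so the two Gamma factors are merely exchanged in the
product. These sums are the Cauchy product coefficients of the squared Bessel series. -/
theorem sum_antidiagonal_inv_Gamma {μ : ℝ} (hμ : 0 ≤ μ) (n : ℕ) :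
    ∑ kl ∈ Finset.HasAntidiagonal.antidiagonal n, 1 / (kl.1.factorial * Real.Gamma (kl.1 + μ + 1)) *
        (1 / (kl.2.factorial * Real.Gamma (kl.2 + μ + 1))) =
      Real.Gamma (2 * n + 2 * μ + 1) /
        (n.factorial * Real.Gamma (n + μ + 1) ^ 2 * Real.Gamma (n + 2 * μ + 1)) := by
  have hG : ∀ (m : ℕ) (y : ℝ), 0 ≤ y → 0 < Real.Gamma (m + y + 1) := fun m y hy =>
    Real.Gamma_pos_of_pos (by positivity)
  have h := Ring.add_choose_eq (r := (n + μ : ℝ)) (s := n + μ) n (Commute.all _ _)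
  rw [ringChoose_eq_Gamma n (by linarith [(Nat.cast_nonneg n : (0 : ℝ) ≤ n)])] at h
  rw [show (n + μ + (n + μ) + 1 : ℝ) = 2 * n + 2 * μ + 1 by ring,
    show (n + μ + (n + μ) - n + 1 : ℝ) = n + 2 * μ + 1 by ring] at h
  have h2 : ∀ kl ∈ Finset.HasAntidiagonal.antidiagonal n,
      Ring.choose (n + μ : ℝ) kl.1 * Ring.choose (n + μ : ℝ) kl.2 =
      Real.Gamma (n + μ + 1) ^ 2 * (1 / (kl.1.factorial * Real.Gamma (kl.1 + μ + 1)) *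
        (1 / (kl.2.factorial * Real.Gamma (kl.2 + μ + 1)))) := by
    rintro ⟨k, l⟩ hkl
    rw [Finset.HasAntidiagonal.mem_antidiagonal] at hkl
    simp only at hkl ⊢
    have hk : (n : ℝ) = k + l := by exact_mod_cast hkl.symm
    rw [ringChoose_eq_Gamma k (by rw [hk]; have := (Nat.cast_nonneg l : (0 : ℝ) ≤ l); linarith),
      ringChoose_eq_Gamma l (by rw [hk]; have := (Nat.cast_nonneg k : (0 : ℝ) ≤ k); linarith),
      show (n + μ - k + 1 : ℝ) = l + μ + 1 by rw [hk]; ring,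
      show (n + μ - l + 1 : ℝ) = k + μ + 1 by rw [hk]; ring]
    have := (hG k μ hμ).ne'
    have := (hG l μ hμ).ne'
    field_simp
  rw [Finset.sum_congr rfl h2, ← Finset.mul_sum] at h
  have h3 := (hG n μ hμ).ne'
  rw [div_mul_eq_div_div_swap, div_eq_iff (by positivity)] at h
  have h4 := (hG n (2 * μ) (by positivity)).ne'
  rw [eq_div_iff (by positivity)]
  field_simp at h ⊢
  linarith

/-! ### Bessel series -/

/-- The `n`-th term of `besselSeries`. -/
noncomputable def besselCoeff (μ x : ℝ) (n : ℕ) : ℝ :=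
  (-x) ^ n / (n.factorial * Real.Gamma (n + μ + 1))

/-- The series `∑ (-x)ⁿ / (n! Γ(n + μ + 1))`, which is `z ^ (-μ) J_μ(2 z)` at `x = z²`. -/
noncomputable def besselSeries (μ x : ℝ) : ℝ :=
  ∑' n : ℕ, besselCoeff μ x n

/-- The series `∑ (-x)ⁿ / (n! (n + μ) Γ(n + ν + 1))`. -/
noncomputable def besselIntegralSeries (μ ν x : ℝ) : ℝ :=
  ∑' n : ℕ, (-x) ^ n / (n.factorial * (n + μ) * Real.Gamma (n + ν + 1))

/-- `Γ` is not monotone near `1`, but each unit step from `μ + 1` multiplies it by a factor at least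
`1`. -/
theorem Gamma_le_Gamma_natCast_add {μ : ℝ} (hμ : 0 ≤ μ) (n : ℕ) :
    Real.Gamma (μ + 1) ≤ Real.Gamma (n + μ + 1) := by
  induction n with
  | zero => simp
  | succ n ih =>
    refine ih.trans ?_
    have h : (1 : ℝ) ≤ n + μ + 1 := by linarith [(Nat.cast_nonneg n : (0 : ℝ) ≤ n)]
    have h' : 0 < n + μ + 1 := by linarith
    rw [show ((n + 1 : ℕ) + μ + 1 : ℝ) = n + μ + 1 + 1 by push_cast; ring,
      Real.Gamma_add_one h'.ne']
    exact le_mul_of_one_le_left (Real.Gamma_pos_of_pos h').le h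

theorem summable_abs_besselSeries {μ : ℝ} (hμ : 0 ≤ μ) (x : ℝ) :
    Summable fun n : ℕ => |besselCoeff μ x n| := by
  have h0 : 0 < Real.Gamma (μ + 1) := Real.Gamma_pos_of_pos (by linarith)
  refine Summable.of_nonneg_of_le (fun n => abs_nonneg _) (fun n => ?_)
    ((Real.summable_pow_div_factorial |x|).mul_right (1 / Real.Gamma (μ + 1)))
  have h1 := Gamma_le_Gamma_natCast_add hμ n
  have h2 : 0 < Real.Gamma (n + μ + 1) := h0.trans_le h1
  rw [besselCoeff, abs_div, abs_pow, abs_neg, abs_of_pos (by positivity : 0 < n.factorial * Real.Gamma (n + μ + 1)),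
    div_mul_div_comm, mul_one]
  gcongr

theorem summable_abs_besselIntegralSeries {μ ν : ℝ} (hμ : 0 < μ) (hν : 0 ≤ ν) (x : ℝ) :
    Summable fun n : ℕ => |(-x) ^ n / (n.factorial * (n + μ) * Real.Gamma (n + ν + 1))| := by
  refine Summable.of_nonneg_of_le (fun n => abs_nonneg _) (fun n => ?_)
    ((summable_abs_besselSeries hν x).mul_right (1 / μ))
  have h2 : 0 < Real.Gamma (n + ν + 1) := Real.Gamma_pos_of_pos (by positivity)
  rw [besselCoeff, abs_div, abs_div, abs_of_pos (by positivity : 0 < n.factorial * Real.Gamma (n + ν + 1)),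
    abs_of_pos (by positivity : 0 < n.factorial * (n + μ) * Real.Gamma (n + ν + 1)),
    div_mul_div_comm, mul_one]
  refine div_le_div_of_nonneg_left (abs_nonneg _) (by positivity) ?_
  rw [mul_right_comm]
  gcongr
  linarith [(Nat.cast_nonneg n : (0 : ℝ) ≤ n)]

theorem besselSeries_mul (μ x t : ℝ) : besselSeries μ (t * x) =
    ∑' n : ℕ, besselCoeff μ x n * t ^ n :=
  tsum_congr fun n => by rw [besselCoeff, besselCoeff, ← mul_neg, mul_pow]; ring

theorem besselIntegralSeries_mul (μ ν x t : ℝ) : besselIntegralSeries μ ν (t * x) =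
    ∑' n : ℕ, (-x) ^ n / (n.factorial * (n + μ) * Real.Gamma (n + ν + 1)) * t ^ n :=
  tsum_congr fun n => by rw [← mul_neg, mul_pow]; ring

/-- Sonine's first integral, integrated once more. -/
theorem setIntegral_betaWeight_besselSeries {μ β : ℝ} (hμ : 0 < μ) (hβ : 0 ≤ β) (x : ℝ) :
    ∫ t in Ioo (0 : ℝ) 1, t ^ (μ - 1) * (1 - t) ^ β * besselSeries μ (t * x) =
      Real.Gamma (β + 1) * besselIntegralSeries μ (μ + β) x := by
  have h := (hasSum_betaWeight hμ (by linarith : 0 < β + 1)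
    (summable_abs_besselSeries hμ.le x)).tsum_eq
  simp only [← besselSeries_mul, add_sub_cancel_right] at h
  rw [← h, besselIntegralSeries, ← tsum_mul_left]
  refine tsum_congr fun n => ?_
  have h1 : 0 < n + μ := by positivity
  have h2 : 0 < Real.Gamma (n + μ) := Real.Gamma_pos_of_pos h1
  have h3 : 0 < Real.Gamma (n + (μ + β) + 1) := Real.Gamma_pos_of_pos (by positivity)
  rw [beta, besselCoeff, Real.Gamma_add_one h1.ne', show μ + n + (β + 1) = n + (μ + β) + 1 by ring,
    add_comm μ (n : ℝ)]
  field_simp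

/-- The beta integral trades `Γ(n + ν + 1)` for `Γ(n + ν + γ + 1)` and leaves the factor `n + μ`
alone. Since the kernel is positive, lower bounds pass from `ν` to `ν + γ`. -/
theorem setIntegral_betaWeight_besselIntegralSeries {μ ν γ : ℝ} (hμ : 0 < μ) (hν : 0 ≤ ν)
    (hγ : 0 < γ) (x : ℝ) :
    ∫ t in Ioo (0 : ℝ) 1, t ^ ν * (1 - t) ^ (γ - 1) * besselIntegralSeries μ ν (t * x) =
      Real.Gamma γ * besselIntegralSeries μ (ν + γ) x := by
  have h := (hasSum_betaWeight (by linarith : 0 < ν + 1) hγ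
    (summable_abs_besselIntegralSeries hμ hν x)).tsum_eq
  simp only [← besselIntegralSeries_mul, add_sub_cancel_right] at h
  rw [← h, besselIntegralSeries, ← tsum_mul_left]
  refine tsum_congr fun n => ?_
  have h2 : 0 < Real.Gamma (n + ν + 1) := Real.Gamma_pos_of_pos (by positivity)
  have h3 : 0 < Real.Gamma (n + (ν + γ) + 1) := Real.Gamma_pos_of_pos (by positivity)
  rw [beta, show ν + 1 + n + γ = n + (ν + γ) + 1 by ring, show ν + 1 + n = n + ν + 1 by ring]
  field_simp

theorem sum_antidiagonal_besselSeries {μ : ℝ} (hμ : 0 ≤ μ) (x : ℝ) (n : ℕ) :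
    ∑ kl ∈ Finset.HasAntidiagonal.antidiagonal n,
        besselCoeff μ x kl.1 * besselCoeff μ x kl.2 =
      (-x) ^ n * (Real.Gamma (2 * n + 2 * μ + 1) /
        (n.factorial * Real.Gamma (n + μ + 1) ^ 2 * Real.Gamma (n + 2 * μ + 1))) := by
  rw [← sum_antidiagonal_inv_Gamma hμ, Finset.mul_sum]
  refine Finset.sum_congr rfl fun kl hkl => ?_
  have : (-x) ^ n = (-x) ^ kl.1 * (-x) ^ kl.2 := by
    rw [← pow_add, Finset.HasAntidiagonal.mem_antidiagonal.1 hkl]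
  rw [this, besselCoeff, besselCoeff]
  ring

theorem besselSeries_sq {μ : ℝ} (hμ : 0 ≤ μ) (x : ℝ) : besselSeries μ x ^ 2 =
    ∑' n : ℕ, (-x) ^ n * (Real.Gamma (2 * n + 2 * μ + 1) /
        (n.factorial * Real.Gamma (n + μ + 1) ^ 2 * Real.Gamma (n + 2 * μ + 1))) := by
  have hs : Summable fun n : ℕ => ‖besselCoeff μ x n‖ := summable_abs_besselSeries hμ x
  have h := tsum_mul_tsum_eq_tsum_sum_antidiagonal_of_summable_norm hs hs
  simp only [sum_antidiagonal_besselSeries hμ] at h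
  rw [sq]
  exact h

theorem summable_abs_besselSeries_sq {μ : ℝ} (hμ : 0 ≤ μ) (x : ℝ) :
    Summable fun n : ℕ => |(-x) ^ n * (Real.Gamma (2 * n + 2 * μ + 1) /
        (n.factorial * Real.Gamma (n + μ + 1) ^ 2 * Real.Gamma (n + 2 * μ + 1)))| := by
  have hs : Summable fun n : ℕ => ‖besselCoeff μ x n‖ := summable_abs_besselSeries hμ x
  have h := summable_norm_sum_mul_antidiagonal_of_summable_norm hs hs
  simp only [sum_antidiagonal_besselSeries hμ] at h
  exact h

/-- The integral of `J_{2μ}(s) / s` over `(0, r)` as an average of squares `J_μ²`. -/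
theorem setIntegral_betaWeight_besselSeries_sq {μ : ℝ} (hμ : 0 < μ) (x : ℝ) :
    ∫ t in Ioo (0 : ℝ) 1, t ^ (μ - 1) * (1 - t) ^ ((1 / 2 : ℝ) - 1) * besselSeries μ (t * x) ^ 2 =
      4 ^ μ * besselIntegralSeries μ (2 * μ) (4 * x) := by
  have h := (hasSum_betaWeight hμ one_half_pos (summable_abs_besselSeries_sq hμ.le x)).tsum_eq
  have h' : ∀ t : ℝ, besselSeries μ (t * x) ^ 2 =
      ∑' n : ℕ, (-x) ^ n * (Real.Gamma (2 * n + 2 * μ + 1) /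
        (n.factorial * Real.Gamma (n + μ + 1) ^ 2 * Real.Gamma (n + 2 * μ + 1))) * t ^ n :=
    fun t => by
      rw [besselSeries_sq hμ.le]
      exact tsum_congr fun n => by rw [← mul_neg, mul_pow]; ring
  simp only [← h'] at h
  rw [← h, besselIntegralSeries, ← tsum_mul_left]
  refine tsum_congr fun n => ?_
  have h1 : 0 < n + μ := by positivity
  have g1 : 0 < Real.Gamma (n + μ) := Real.Gamma_pos_of_pos h1
  have g2 : 0 < Real.Gamma (n + μ + 1 / 2) := Real.Gamma_pos_of_pos (by positivity)
  have g3 : 0 < Real.Gamma (n + 2 * μ + 1) := Real.Gamma_pos_of_pos (by positivity)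
  -- Legendre duplication splits `Γ(2n + 2μ + 1)`: one factor cancels the beta denominator `Γ(n + μ
  -- + 1/2)`, the other one of the `Γ(n + μ + 1)`, and the power `4 ^ (n + μ)` rescales the argument
  -- to `4 * x`.
  have hdup := Real.Gamma_mul_Gamma_add_half (n + μ + 1 / 2)
  rw [show n + μ + 1 / 2 + 1 / 2 = n + μ + 1 by ring,
    show 2 * (n + μ + 1 / 2) = 2 * n + 2 * μ + 1 by ring,
    show 1 - (2 * n + 2 * μ + 1) = -(2 * (n + μ)) by ring, Real.rpow_neg two_pos.le,
    Real.rpow_mul two_pos.le, show (2 : ℝ) ^ (2 : ℝ) = 4 by norm_num,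
    Real.rpow_add (by norm_num), Real.rpow_natCast, Real.Gamma_add_one h1.ne'] at hdup
  have hpi : 0 < √Real.pi := Real.sqrt_pos.2 Real.pi_pos
  have hdup' : Real.Gamma (2 * n + 2 * μ + 1) = Real.Gamma (n + μ + 1 / 2) *
      ((n + μ) * Real.Gamma (n + μ)) * (4 ^ n * 4 ^ μ) / √Real.pi := by
    rw [hdup]; field_simp
  rw [beta, Real.Gamma_one_half_eq, hdup', Real.Gamma_add_one h1.ne', add_comm μ (n : ℝ),
    show -(4 * x) = 4 * -x by ring, mul_pow]
  field_simp
  rw [← mul_pow]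
  ring

/-! ### Lower bounds for the Bessel series -/

theorem integrableOn_betaWeight_mul_tsum {a b : ℝ} (ha : 0 < a) (hb : 0 < b) {c : ℕ → ℝ}
    (hc : Summable fun n => |c n|) :
    IntegrableOn (fun t : ℝ => t ^ (a - 1) * (1 - t) ^ (b - 1) * ∑' n, c n * t ^ n)
      (Ioo 0 1) := by
  have hb1 : ∀ t ∈ Ioo (0 : ℝ) 1, ∀ n, ‖c n * t ^ n‖ ≤ |c n| := fun t ht n => by
    rw [norm_mul, Real.norm_eq_abs, norm_pow, Real.norm_of_nonneg ht.1.le]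
    exact mul_le_of_le_one_right (abs_nonneg _) (pow_le_one₀ ht.1.le ht.2.le)
  have hcont : ContinuousOn (fun t : ℝ => ∑' n, c n * t ^ n) (Ioo 0 1) :=
    continuousOn_tsum (fun n => by fun_prop) hc fun n t ht => hb1 t ht n
  refine (integrableOn_betaWeight ha hb).mul_bdd (c := ∑' n, |c n|)
    (hcont.aestronglyMeasurable measurableSet_Ioo) ?_
  refine (ae_restrict_mem measurableSet_Ioo).mono fun t ht => ?_
  exact tsum_of_norm_bounded hc.hasSum (hb1 t ht)

/-- The term `n = 0` is `1 / Γ(μ + 1)`, and the others are dominated by a geometric series of sum `y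
/ (1 - y) ≤ 1/2` times that term. -/
theorem one_div_two_mul_Gamma_le_besselSeries {μ y : ℝ} (hμ : 0 ≤ μ) (hy : 0 ≤ y)
    (hy' : y ≤ 1 / 3) : 1 / (2 * Real.Gamma (μ + 1)) ≤ besselSeries μ y := by
  have h0 : 0 < Real.Gamma (μ + 1) := Real.Gamma_pos_of_pos (by linarith)
  have hs : Summable (besselCoeff μ y) := (summable_abs_besselSeries hμ y).of_abs
  have hgeom : HasSum (fun n : ℕ => y / Real.Gamma (μ + 1) * y ^ n)
      (y / Real.Gamma (μ + 1) * (1 - y)⁻¹) :=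
    (hasSum_geometric_of_lt_one hy (by linarith)).mul_left _
  have htail := tsum_of_norm_bounded (f := fun n => besselCoeff μ y (n + 1)) hgeom fun n => by
    have h1 := Gamma_le_Gamma_natCast_add hμ (n + 1)
    have h2 : (1 : ℝ) ≤ ((n + 1).factorial : ℝ) := by
      exact_mod_cast Nat.one_le_iff_ne_zero.2 (Nat.factorial_ne_zero _)
    rw [besselCoeff, norm_div, norm_pow, norm_neg, Real.norm_of_nonneg hy,
      Real.norm_of_nonneg (mul_nonneg (by positivity) (h0.le.trans h1)), div_mul_eq_mul_div,
      ← pow_succ']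
    refine div_le_div_of_nonneg_left (by positivity) h0 (h1.trans ?_)
    exact le_mul_of_one_le_left (h0.le.trans h1) h2
  have hle : y / Real.Gamma (μ + 1) * (1 - y)⁻¹ ≤ 1 / (2 * Real.Gamma (μ + 1)) := by
    rw [← div_eq_mul_inv, div_div, div_le_div_iff₀ (by nlinarith) (by positivity)]
    nlinarith
  have h00 : besselCoeff μ y 0 = 1 / Real.Gamma (μ + 1) := by simp [besselCoeff]
  rw [besselSeries, hs.tsum_eq_zero_add, h00]
  have := (abs_le.1 (htail.trans hle)).1
  have h3 : 1 / Real.Gamma (μ + 1) = 2 * (1 / (2 * Real.Gamma (μ + 1))) := by field_simp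
  rw [h3]
  linarith

/-- In the average of squares, only `t < min(1, 1/x)` is kept; there the Bessel series stays near
its value at `0`, and the mass of `t ^ (μ - 1)` gives `min(1, x ^ (-μ))`. -/
theorem exists_le_besselIntegralSeries_two_mul {μ : ℝ} (hμ : 0 < μ) :
    ∃ c : ℝ, 0 < c ∧ ∀ x : ℝ, 0 < x →
      c * min 1 (x ^ (-μ)) ≤ besselIntegralSeries μ (2 * μ) x := by
  have h0 : 0 < Real.Gamma (μ + 1) := Real.Gamma_pos_of_pos (by linarith)
  set κ := 1 / (2 * Real.Gamma (μ + 1)) with hκ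
  have hκ0 : 0 < κ := by positivity
  have h4 : (0 : ℝ) < 4 ^ μ := by positivity
  -- `κ ^ 2` bounds the squared series, `1 / μ` comes from integrating `t ^ (μ - 1)`, and `4 ^ μ` is
  -- the prefactor of the square identity.
  refine ⟨κ ^ 2 / (4 ^ μ * μ), by positivity, fun x hx => ?_⟩
  set m := min 1 (1 / x) with hm
  have hm0 : 0 < m := by positivity
  have hm1 : m ≤ 1 := min_le_left _ _
  have hkey := setIntegral_betaWeight_besselSeries_sq hμ (x / 4)
  rw [mul_div_cancel₀ x (by norm_num : (4 : ℝ) ≠ 0)] at hkey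
  have hint : IntegrableOn (fun t : ℝ => t ^ (μ - 1) * (1 - t) ^ ((1 / 2 : ℝ) - 1) *
      besselSeries μ (t * (x / 4)) ^ 2) (Ioo 0 1) := by
    have := integrableOn_betaWeight_mul_tsum hμ one_half_pos
      (summable_abs_besselSeries_sq hμ.le (x / 4))
    refine this.congr_fun (fun t ht => ?_) measurableSet_Ioo
    simp only
    rw [besselSeries_sq hμ.le]
    congr 1
    exact tsum_congr fun n => by rw [← mul_neg, mul_pow]; ring
  have hsub : Ioo 0 m ⊆ Ioo (0 : ℝ) 1 := Ioo_subset_Ioo_right hm1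
  have hrpow : IntegrableOn (fun t : ℝ => t ^ (μ - 1) * κ ^ 2) (Ioo 0 m) := by
    have h := intervalIntegral.intervalIntegrable_rpow' (a := 0) (b := m) (r := μ - 1)
      (by linarith)
    rw [intervalIntegrable_iff_integrableOn_Ioo_of_le hm0.le] at h
    exact h.mul_const _
  have hval : ∫ t in Ioo 0 m, t ^ (μ - 1) * κ ^ 2 = m ^ μ / μ * κ ^ 2 := by
    rw [integral_mul_const, ← integral_Ioc_eq_integral_Ioo,
      ← intervalIntegral.integral_of_le hm0.le, integral_rpow (Or.inl (by linarith)),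
      sub_add_cancel, Real.zero_rpow hμ.ne', sub_zero]
  have hlow : m ^ μ / μ * κ ^ 2 ≤ 4 ^ μ * besselIntegralSeries μ (2 * μ) x := by
    rw [← hkey, ← hval]
    refine le_trans (setIntegral_mono_on hrpow (hint.mono_set hsub) measurableSet_Ioo
      fun t ht => ?_) (setIntegral_mono_set hint ?_ hsub.eventuallyLE)
    · have ht1 : t < 1 := ht.2.trans_le hm1
      have e1 : (1 : ℝ) ≤ (1 - t) ^ ((1 / 2 : ℝ) - 1) :=
        Real.one_le_rpow_of_pos_of_le_one_of_nonpos (by linarith) (by linarith [ht.1])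
          (by norm_num)
      have e2 : t * (x / 4) ≤ 1 / 3 := by
        have : t * x ≤ 1 := by
          rw [← le_div_iff₀ hx]
          exact ht.2.le.trans (min_le_right _ _)
        linarith
      have e3 := one_div_two_mul_Gamma_le_besselSeries hμ.le
        (mul_nonneg ht.1.le (by positivity : (0 : ℝ) ≤ x / 4)) e2
      have e4 : (0 : ℝ) ≤ t ^ (μ - 1) := Real.rpow_nonneg ht.1.le _
      refine mul_le_mul (le_mul_of_one_le_right e4 e1) ?_ (by positivity) (by positivity)
      exact pow_le_pow_left₀ hκ0.le e3 2
    · refine (ae_restrict_mem measurableSet_Ioo).mono fun t ht => ?_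
      exact mul_nonneg (betaWeight_nonneg ht) (sq_nonneg _)
  have hmin : min 1 (x ^ (-μ)) = m ^ μ := by
    rw [hm, Real.rpow_neg hx.le, ← Real.inv_rpow hx.le, ← one_div]
    rcases le_total 1 (1 / x) with h | h
    · rw [min_eq_left h, Real.one_rpow, min_eq_left (Real.one_le_rpow h hμ.le)]
    · rw [min_eq_right h, min_eq_right (Real.rpow_le_one (by positivity) h hμ.le)]
  rw [hmin]
  calc κ ^ 2 / (4 ^ μ * μ) * m ^ μ = (m ^ μ / μ * κ ^ 2) / 4 ^ μ := by field_simp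
    _ ≤ _ := by rw [div_le_iff₀ h4]; linarith

/-- The case `β = μ` is averaged against a beta density of parameter `β - μ`; as `t < 1`, `min(1, (t
x) ^ (-μ))` is at least `min(1, x ^ (-μ))`. -/
theorem exists_le_besselIntegralSeries {μ β : ℝ} (hμ : 0 < μ) (hβ : μ ≤ β) :
    ∃ c : ℝ, 0 < c ∧ ∀ x : ℝ, 0 < x →
      c * min 1 (x ^ (-μ)) ≤ besselIntegralSeries μ (μ + β) x := by
  obtain ⟨c, hc, h⟩ := exists_le_besselIntegralSeries_two_mul hμ
  rcases hβ.eq_or_lt with rfl | hlt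
  · exact ⟨c, hc, by simpa only [two_mul] using h⟩
  set γ := β - μ with hγ
  have hγ0 : 0 < γ := by linarith
  have hΓ : 0 < Real.Gamma γ := Real.Gamma_pos_of_pos hγ0
  have hB : 0 < beta (2 * μ + 1) γ := beta_pos (by positivity) hγ0
  refine ⟨c * beta (2 * μ + 1) γ / Real.Gamma γ, by positivity, fun x hx => ?_⟩
  have hkey := setIntegral_betaWeight_besselIntegralSeries hμ (by positivity : 0 ≤ 2 * μ) hγ0 x
  rw [show 2 * μ + γ = μ + β by rw [hγ]; ring] at hkey
  have hint : IntegrableOn (fun t : ℝ => t ^ (2 * μ) * (1 - t) ^ (γ - 1) *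
      besselIntegralSeries μ (2 * μ) (t * x)) (Ioo 0 1) := by
    have := integrableOn_betaWeight_mul_tsum (by positivity : 0 < 2 * μ + 1) hγ0
      (summable_abs_besselIntegralSeries hμ (by positivity : 0 ≤ 2 * μ) x)
    simpa only [← besselIntegralSeries_mul, add_sub_cancel_right] using this
  have hW := integrableOn_betaWeight (by positivity : 0 < 2 * μ + 1) hγ0
  have hval := setIntegral_betaWeight (by positivity : 0 < 2 * μ + 1) hγ0
  simp only [add_sub_cancel_right] at hW hval
  have hlow : beta (2 * μ + 1) γ * (c * min 1 (x ^ (-μ))) ≤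
      Real.Gamma γ * besselIntegralSeries μ (μ + β) x := by
    rw [← hkey, ← hval, ← integral_mul_const]
    refine setIntegral_mono_on (hW.mul_const _) hint measurableSet_Ioo fun t ht => ?_
    refine mul_le_mul_of_nonneg_left ?_ ?_
    · refine le_trans ?_ (h (t * x) (mul_pos ht.1 hx))
      refine mul_le_mul_of_nonneg_left (min_le_min le_rfl ?_) hc.le
      exact Real.rpow_le_rpow_of_nonpos (mul_pos ht.1 hx)
        (mul_le_of_le_one_left hx.le ht.2.le) (by linarith)
    · exact mul_nonneg (Real.rpow_nonneg ht.1.le _) (Real.rpow_nonneg (by linarith [ht.2]) _)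
  calc c * beta (2 * μ + 1) γ / Real.Gamma γ * min 1 (x ^ (-μ)) =
      (beta (2 * μ + 1) γ * (c * min 1 (x ^ (-μ)))) / Real.Gamma γ := by ring
    _ ≤ _ := by rw [div_le_iff₀ hΓ]; linarith

/-! ### Moments of Gaussians and of balls -/

theorem integrable_pow_mul_exp_neg_sq (n : ℕ) :
    Integrable fun x : ℝ => x ^ (2 * n) * Real.exp (-x ^ 2) := by
  have h := integrable_rpow_mul_exp_neg_mul_sq one_pos (s := (2 * n : ℕ))
    (by have := (Nat.cast_nonneg (2 * n) : (0 : ℝ) ≤ _); linarith)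
  simpa only [Real.rpow_natCast, neg_one_mul] using h

theorem integral_pow_mul_exp_neg_sq (n : ℕ) :
    ∫ x : ℝ, x ^ (2 * n) * Real.exp (-x ^ 2) =
      √Real.pi * ((2 * n).factorial / (4 ^ n * n.factorial)) := by
  have h1 : ∫ x : ℝ, x ^ (2 * n) * Real.exp (-x ^ 2) =
      2 * ∫ x in Ioi (0 : ℝ), x ^ (2 * n) * Real.exp (-x ^ 2) := by
    rw [← integral_comp_abs (f := fun x => x ^ (2 * n) * Real.exp (-x ^ 2))]
    simp only [pow_mul, sq_abs]
  have h2 := integral_rpow_mul_exp_neg_rpow (p := 2) (q := (2 * n : ℕ)) two_pos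
    (by have := (Nat.cast_nonneg (2 * n) : (0 : ℝ) ≤ _); linarith)
  simp only [Real.rpow_natCast, Real.rpow_two] at h2
  rw [h1, h2]
  have hd := Real.Gamma_mul_Gamma_add_half (n + 1 / 2)
  rw [show (n + 1 / 2 + 1 / 2 : ℝ) = n + 1 by ring,
    show (2 * (n + 1 / 2) : ℝ) = (2 * n : ℕ) + 1 by push_cast; ring, Real.Gamma_nat_eq_factorial,
    Real.Gamma_nat_eq_factorial, show (1 - ((2 * n : ℕ) + 1) : ℝ) = -(2 * n : ℕ) by ring,
    Real.rpow_neg two_pos.le, Real.rpow_natCast, pow_mul,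
    show (2 : ℝ) ^ 2 = 4 by norm_num] at hd
  rw [show (((2 * n : ℕ) + 1) / 2 : ℝ) = n + 1 / 2 by push_cast; ring]
  have hn : (n.factorial : ℝ) ≠ 0 := by positivity
  rw [← eq_div_iff hn] at hd
  rw [hd]
  field_simp

theorem exp_neg_norm_sq_mul_coord_pow {d : ℕ} (i : Fin d) (n : ℕ) (x : Fin d → ℝ) :
    x i ^ (2 * n) * Real.exp (-‖(WithLp.toLp 2 x : EuclideanSpace ℝ (Fin d))‖ ^ 2) =
      ∏ j, (if j = i then x j ^ (2 * n) else 1) * Real.exp (-x j ^ 2) := by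
  rw [Finset.prod_mul_distrib, Finset.prod_ite_eq' , if_pos (Finset.mem_univ i),
    ← Real.exp_sum, EuclideanSpace.real_norm_sq_eq, Finset.sum_neg_distrib]

theorem integral_coord_pow_mul_exp_neg_norm_sq {d : ℕ} (i : Fin d) (n : ℕ) :
    Integrable (fun x : EuclideanSpace ℝ (Fin d) => x i ^ (2 * n) * Real.exp (-‖x‖ ^ 2)) ∧
    ∫ x : EuclideanSpace ℝ (Fin d), x i ^ (2 * n) * Real.exp (-‖x‖ ^ 2) =
      √Real.pi ^ d * ((2 * n).factorial / (4 ^ n * n.factorial)) := by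
  have hf : ∀ j : Fin d, Integrable (fun x : ℝ =>
      (if j = i then x ^ (2 * n) else 1) * Real.exp (-x ^ 2)) ∧
      ∫ x : ℝ, (if j = i then x ^ (2 * n) else 1) * Real.exp (-x ^ 2) =
        √Real.pi * (if j = i then ((2 * n).factorial / (4 ^ n * n.factorial) : ℝ) else 1) := by
    intro j
    by_cases h : j = i
    · simpa only [h, if_true] using
        ⟨integrable_pow_mul_exp_neg_sq n, integral_pow_mul_exp_neg_sq n⟩
    · simpa [h] using
        And.intro (integrable_pow_mul_exp_neg_sq 0) (integral_pow_mul_exp_neg_sq 0)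
  constructor
  · rw [← (PiLp.volume_preserving_toLp (Fin d)).integrable_comp_emb
      (MeasurableEquiv.toLp 2 _).measurableEmbedding]
    simp only [Function.comp_def, exp_neg_norm_sq_mul_coord_pow]
    exact Integrable.fintype_prod fun j => (hf j).1
  · rw [← (PiLp.volume_preserving_toLp (Fin d)).integral_comp
      (MeasurableEquiv.toLp 2 _).measurableEmbedding]
    simp only [exp_neg_norm_sq_mul_coord_pow]
    rw [integral_fintype_prod_volume_eq_prod
      (fun j (y : ℝ) => (if j = i then y ^ (2 * n) else 1) * Real.exp (-y ^ 2))]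
    simp only [fun j => (hf j).2]
    rw [Finset.prod_mul_distrib, Finset.prod_ite_eq', if_pos (Finset.mem_univ i)]
    simp

/-- By rotation invariance: a reflection carries `‖e‖` times a basis vector to `e`, which reduces
the moment to that of one coordinate. -/
theorem integral_inner_pow_mul_exp_neg_norm_sq {d : ℕ} (hd : 1 ≤ d)
    (e : EuclideanSpace ℝ (Fin d)) (n : ℕ) :
    Integrable (fun x : EuclideanSpace ℝ (Fin d) =>
      inner ℝ x e ^ (2 * n) * Real.exp (-‖x‖ ^ 2)) ∧
    ∫ x : EuclideanSpace ℝ (Fin d), inner ℝ x e ^ (2 * n) * Real.exp (-‖x‖ ^ 2) =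
      √Real.pi ^ d * ((2 * n).factorial / (4 ^ n * n.factorial)) * ‖e‖ ^ (2 * n) := by
  set i : Fin d := ⟨0, hd⟩
  set v : EuclideanSpace ℝ (Fin d) := EuclideanSpace.single i ‖e‖ with hv
  have hnorm : ‖v‖ = ‖e‖ := by simp [hv]
  set R := (Submodule.span ℝ {v - e})ᗮ.reflection with hR
  have hRe : R v = e := Submodule.reflection_sub hnorm
  have hin : ∀ x, inner ℝ (R x) e = x i * ‖e‖ := fun x => by
    rw [← hRe, LinearIsometryEquiv.inner_map_map, hv, EuclideanSpace.inner_single_right]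
    simp [mul_comm]
  have hmp : MeasurePreserving R volume volume := R.measurePreserving
  have hemb : MeasurableEmbedding R := R.toHomeomorph.measurableEmbedding
  have hcomp : ∀ x, inner ℝ (R x) e ^ (2 * n) * Real.exp (-‖R x‖ ^ 2) =
      x i ^ (2 * n) * Real.exp (-‖x‖ ^ 2) * ‖e‖ ^ (2 * n) := fun x => by
    rw [hin, R.norm_map, mul_pow]; ring
  have hbase := integral_coord_pow_mul_exp_neg_norm_sq i n
  constructor
  · rw [← hmp.integrable_comp_emb hemb]
    simp only [Function.comp_def, hcomp]
    exact hbase.1.mul_const _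
  · rw [← hmp.integral_comp hemb]
    simp only [hcomp]
    rw [integral_mul_const, hbase.2]

theorem setIntegral_ball_inner_pow_eq_mul {d : ℕ} (e : EuclideanSpace ℝ (Fin d)) (n : ℕ) {r : ℝ}
    (hr : 0 < r) :
    ∫ x in Metric.ball (0 : EuclideanSpace ℝ (Fin d)) r, inner ℝ x e ^ (2 * n) =
      r ^ (d + 2 * n) *
        ∫ x in Metric.ball (0 : EuclideanSpace ℝ (Fin d)) 1, inner ℝ x e ^ (2 * n) := by
  have h := Measure.setIntegral_comp_smul_of_pos volume
    (fun x : EuclideanSpace ℝ (Fin d) => inner ℝ x e ^ (2 * n)) (Metric.ball 0 1) hr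
  rw [smul_unitBall hr.ne', Real.norm_of_nonneg hr.le, finrank_euclideanSpace_fin] at h
  simp only [inner_smul_left, mul_pow, integral_const_mul, smul_eq_mul, conj_trivial] at h
  rw [eq_inv_mul_iff_mul_eq₀ (by positivity)] at h
  rw [← h, pow_add]
  ring

theorem integrableOn_ball_of_continuous {d : ℕ} {f : EuclideanSpace ℝ (Fin d) → ℝ}
    (hf : Continuous f) (r : ℝ) : IntegrableOn f (Metric.ball 0 r) :=
  (hf.continuousOn.integrableOn_compact (isCompact_closedBall 0 r)).mono_set
    Metric.ball_subset_closedBall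

/-- Ball moments are read off from Gaussian ones. Writing `exp(-‖x‖²)` as the integral of `exp(-s)`
over `s > ‖x‖²` and exchanging integrals gives the moments of the balls of radius `√s`; by
homogeneity these integrate to the unit ball moment times `Γ(n + d/2 + 1)`. -/
theorem setIntegral_ball_inner_pow {d : ℕ} (hd : 1 ≤ d) (e : EuclideanSpace ℝ (Fin d)) (n : ℕ)
    {r : ℝ} (hr : 0 < r) :
    ∫ x in Metric.ball (0 : EuclideanSpace ℝ (Fin d)) r, inner ℝ x e ^ (2 * n) =
      √Real.pi ^ d * ((2 * n).factorial / (4 ^ n * n.factorial)) * ‖e‖ ^ (2 * n) *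
        r ^ (d + 2 * n) / Real.Gamma (n + d / 2 + 1) := by
  obtain ⟨hint, hval⟩ := integral_inner_pow_mul_exp_neg_norm_sq hd e n
  set A := ∫ x in Metric.ball (0 : EuclideanSpace ℝ (Fin d)) 1, inner ℝ x e ^ (2 * n) with hA
  have hG : 0 < Real.Gamma (n + d / 2 + 1) := Real.Gamma_pos_of_pos (by positivity)
  suffices h : A * Real.Gamma (n + d / 2 + 1) =
      √Real.pi ^ d * ((2 * n).factorial / (4 ^ n * n.factorial)) * ‖e‖ ^ (2 * n) by
    rw [setIntegral_ball_inner_pow_eq_mul e n hr, ← hA, ← h]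
    field_simp
  rw [← hval]
  let F : EuclideanSpace ℝ (Fin d) → ℝ → ℝ := fun x s =>
    inner ℝ x e ^ (2 * n) * (Ioi (‖x‖ ^ 2)).indicator (fun s => Real.exp (-s)) s
  have hFx : ∀ x, ∫ s, F x s = inner ℝ x e ^ (2 * n) * Real.exp (-‖x‖ ^ 2) := fun x => by
    simp only [F]
    rw [integral_const_mul, integral_indicator measurableSet_Ioi, integral_exp_neg_Ioi]
  have hFint : ∀ x, Integrable (F x) := fun x =>
    ((integrable_indicator_iff measurableSet_Ioi).2 (integrableOn_exp_neg_Ioi _)).const_mul _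
  have hFnn : ∀ x s, 0 ≤ F x s := fun x s =>
    mul_nonneg (by rw [pow_mul]; positivity) (indicator_nonneg (fun _ _ => (Real.exp_pos _).le) _)
  have hmeas : AEStronglyMeasurable (Function.uncurry F)
      ((volume : Measure (EuclideanSpace ℝ (Fin d))).prod volume) := by
    have : Function.uncurry F = fun p : EuclideanSpace ℝ (Fin d) × ℝ =>
        inner ℝ p.1 e ^ (2 * n) *
          ({p | ‖p.1‖ ^ 2 < p.2} : Set (EuclideanSpace ℝ (Fin d) × ℝ)).indicator
            (fun p => Real.exp (-p.2)) p := by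
      funext ⟨x, s⟩
      simp only [Function.uncurry, F, indicator, mem_Ioi, mem_ofPred_eq]
    rw [this]
    have hm : MeasurableSet ({p | ‖p.1‖ ^ 2 < p.2} : Set (EuclideanSpace ℝ (Fin d) × ℝ)) :=
      measurableSet_lt (by fun_prop) (by fun_prop)
    exact (Measurable.mul (by fun_prop)
      (Measurable.indicator (by fun_prop) hm)).aestronglyMeasurable
  have hprod : Integrable (Function.uncurry F)
      ((volume : Measure (EuclideanSpace ℝ (Fin d))).prod volume) := by
    rw [integrable_prod_iff hmeas]
    refine ⟨Filter.Eventually.of_forall hFint, ?_⟩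
    simp only [Function.uncurry, Real.norm_of_nonneg (hFnn _ _), hFx]
    exact hint
  have hswap := integral_integral_swap hprod
  simp only [hFx] at hswap
  rw [hswap, ← setIntegral_eq_integral_of_forall_compl_eq_zero (s := Ioi 0)]
  · have hs : ∀ s ∈ Ioi (0 : ℝ), ∫ x, F x s =
        A * (Real.exp (-s) * s ^ ((n + d / 2 + 1 : ℝ) - 1)) := by
      intro s hs
      have hs0 : (0 : ℝ) < s := hs
      have : ∀ x, F x s = (Metric.ball (0 : EuclideanSpace ℝ (Fin d)) √s).indicator
          (fun x => inner ℝ x e ^ (2 * n) * Real.exp (-s)) x := fun x => by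
        simp only [F, indicator, mem_Ioi, mem_ball_zero_iff, Real.lt_sqrt (norm_nonneg x)]
        split_ifs <;> simp
      simp only [this]
      rw [integral_indicator Metric.isOpen_ball.measurableSet, integral_mul_const,
        setIntegral_ball_inner_pow_eq_mul e n (Real.sqrt_pos.2 hs0), ← hA,
        Real.sqrt_eq_rpow, ← Real.rpow_natCast, ← Real.rpow_mul hs0.le]
      have : (1 / 2 * (d + 2 * n : ℕ) : ℝ) = (n + d / 2 + 1 : ℝ) - 1 := by push_cast; ring
      rw [this]
      ring
    rw [setIntegral_congr_fun measurableSet_Ioi hs, integral_const_mul,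
      ← Real.Gamma_eq_integral (by positivity)]
  · intro s hs
    have : ∀ x, F x s = 0 := fun x => by
      have : s ∉ Ioi (‖x‖ ^ 2) := fun h => hs ((sq_nonneg ‖x‖).trans_lt h)
      simp [F, this]
    simp [this]

/-! ### The Fourier transform of a ball -/

/-- Conjugation flips the sign in the exponential, and the substitution `x ↦ -x` flips it back. -/
theorem conj_fourier_of_even {d : ℕ} {f : EuclideanSpace ℝ (Fin d) → ℝ} (hf : ∀ x, f (-x) = f x)
    (ξ : EuclideanSpace ℝ (Fin d)) :
    (starRingEnd ℂ) (𝓕 (fun x => (f x : ℂ)) ξ) = 𝓕 (fun x => (f x : ℂ)) ξ := by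
  rw [Real.fourier_eq', ← integral_conj]
  conv_rhs => rw [← integral_neg_eq_self]
  congr 1
  funext x
  rw [smul_eq_mul, smul_eq_mul, map_mul, Complex.conj_ofReal, ← Complex.exp_conj, map_mul,
    Complex.conj_I, Complex.conj_ofReal, inner_neg_left, hf]
  push_cast
  ring_nf

theorem fourier_im_eq_zero_of_even {d : ℕ} {f : EuclideanSpace ℝ (Fin d) → ℝ}
    (hf : ∀ x, f (-x) = f x) (ξ : EuclideanSpace ℝ (Fin d)) :
    (𝓕 (fun x => (f x : ℂ)) ξ).im = 0 :=
  Complex.conj_eq_iff_im.1 (conj_fourier_of_even hf ξ)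

theorem fourier_re_eq_integral_cos {d : ℕ} {f : EuclideanSpace ℝ (Fin d) → ℝ}
    (hf : Integrable f) (ξ : EuclideanSpace ℝ (Fin d)) :
    (𝓕 (fun x => (f x : ℂ)) ξ).re = ∫ x, Real.cos (2 * Real.pi * inner ℝ x ξ) * f x := by
  rw [Real.fourier_eq']
  have hre : ∀ x, (Complex.exp (↑(-2 * Real.pi * inner ℝ x ξ) * Complex.I) • (f x : ℂ)).re =
      Real.cos (2 * Real.pi * inner ℝ x ξ) * f x := fun x => by
    rw [smul_eq_mul, Complex.re_mul_ofReal, Complex.exp_ofReal_mul_I_re, ← Real.cos_neg]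
    ring_nf
  have hint : Integrable fun x =>
      Complex.exp (↑(-2 * Real.pi * inner ℝ x ξ) * Complex.I) • (f x : ℂ) := by
    refine hf.ofReal.bdd_mul (c := 1) (by fun_prop) (Filter.Eventually.of_forall fun x => ?_)
    rw [Complex.norm_exp_ofReal_mul_I]
  have h := integral_re hint
  simp only [RCLike.re_eq_complex_re, hre] at h
  exact h.symm

/-- The indicator function of the ball of radius `r`. -/
noncomputable def ballIndicator (d : ℕ) (r : ℝ) : EuclideanSpace ℝ (Fin d) → ℝ :=
  (Metric.ball 0 r).indicator fun _ => 1

theorem integrable_ballIndicator (d : ℕ) (r : ℝ) : Integrable (ballIndicator d r) :=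
  (integrable_indicator_iff Metric.isOpen_ball.measurableSet).2
    (integrableOn_ball_of_continuous continuous_const r)

/-- The cosine series is integrated termwise; its `(2n)!` cancels the one in the ball moments and
leaves `n! Γ(n + d/2 + 1)`. -/
theorem setIntegral_ball_cos {d : ℕ} (hd : 1 ≤ d) {r : ℝ} (hr : 0 < r)
    (ξ : EuclideanSpace ℝ (Fin d)) :
    ∫ x in Metric.ball (0 : EuclideanSpace ℝ (Fin d)) r, Real.cos (2 * Real.pi * inner ℝ x ξ) =
      √Real.pi ^ d * r ^ d * besselSeries (d / 2) (Real.pi ^ 2 * r ^ 2 * ‖ξ‖ ^ 2) := by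
  set X := Real.pi ^ 2 * r ^ 2 * ‖ξ‖ ^ 2 with hX
  set b : ℕ → ℝ := fun n => (2 * Real.pi) ^ (2 * n) / (2 * n).factorial with hb
  have hb0 : ∀ n, 0 ≤ b n := fun n => by positivity
  have hcos : ∀ x, Real.cos (2 * Real.pi * inner ℝ x ξ) =
      ∑' n : ℕ, (-1) ^ n * (b n * inner ℝ x ξ ^ (2 * n)) := fun x => by
    rw [← (Real.hasSum_cos _).tsum_eq]
    refine tsum_congr fun n => ?_
    rw [hb, mul_pow]
    ring
  have hmom : ∀ n : ℕ, ∫ x in Metric.ball (0 : EuclideanSpace ℝ (Fin d)) r,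
      b n * inner ℝ x ξ ^ (2 * n) =
        √Real.pi ^ d * r ^ d * (X ^ n / (n.factorial * Real.Gamma (n + d / 2 + 1))) := fun n => by
    have hG : 0 < Real.Gamma (n + d / 2 + 1) := Real.Gamma_pos_of_pos (by positivity)
    rw [integral_const_mul, setIntegral_ball_inner_pow hd ξ n hr, hb, hX]
    simp only [mul_pow, ← pow_mul, pow_add]
    rw [pow_mul (2 : ℝ), show (2 : ℝ) ^ 2 = 4 by norm_num]
    field_simp
  have hcoef : ∀ n : ℕ, (-1) ^ n * (X ^ n / (n.factorial * Real.Gamma (n + d / 2 + 1))) =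
      besselCoeff (d / 2) X n := fun n => by
    rw [besselCoeff, neg_pow X]
    ring
  have hX0 : 0 ≤ X := by positivity
  simp only [hcos]
  rw [← integral_tsum_of_summable_integral_norm]
  · rw [besselSeries, ← tsum_mul_left]
    refine tsum_congr fun n => ?_
    rw [integral_const_mul, hmom, ← hcoef]
    ring
  · intro n
    exact integrableOn_ball_of_continuous (by fun_prop) r
  · have hs := (summable_abs_besselSeries (by positivity : (0 : ℝ) ≤ d / 2) X).mul_left
      (√Real.pi ^ d * r ^ d)
    refine hs.congr fun n => ?_
    have hn : ∀ x : EuclideanSpace ℝ (Fin d),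
        ‖(-1) ^ n * (b n * inner ℝ x ξ ^ (2 * n))‖ = b n * inner ℝ x ξ ^ (2 * n) := fun x => by
      rw [norm_mul, norm_pow, norm_neg, norm_one, one_pow, one_mul, Real.norm_of_nonneg]
      rw [pow_mul _ 2 n]
      exact mul_nonneg (hb0 n) (by positivity)
    simp only [hn]
    have hG : 0 < Real.Gamma (n + d / 2 + 1) := Real.Gamma_pos_of_pos (by positivity)
    rw [hmom, ← hcoef, abs_mul, abs_pow, abs_neg, abs_one, one_pow, one_mul,
      abs_of_nonneg (by positivity)]

theorem fourier_ballIndicator {d : ℕ} (hd : 1 ≤ d) {r : ℝ} (hr : 0 < r)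
    (ξ : EuclideanSpace ℝ (Fin d)) :
    (𝓕 (fun x => (ballIndicator d r x : ℂ)) ξ).re =
      √Real.pi ^ d * r ^ d * besselSeries (d / 2) (Real.pi ^ 2 * r ^ 2 * ‖ξ‖ ^ 2) := by
  rw [fourier_re_eq_integral_cos (integrable_ballIndicator d r), ← setIntegral_ball_cos hd hr,
    ← integral_indicator Metric.isOpen_ball.measurableSet]
  congr 1
  funext x
  simp only [ballIndicator, indicator]
  split_ifs <;> simp

/-! ### Radial integrals against Bochner-Riesz weights -/

/-- Polar coordinates followed by `u = ‖ξ‖²` turn the weight into a beta density with parameters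
`d/2` and `β + 1`. -/
theorem integral_posPow_mul_norm_sq {d : ℕ} (hd : 1 ≤ d) (β : ℝ) (F : ℝ → ℝ) :
    ∫ ξ : EuclideanSpace ℝ (Fin d), posPow (1 - ‖ξ‖ ^ 2) β * F (‖ξ‖ ^ 2) =
      d / 2 * volume.real (Metric.ball (0 : EuclideanSpace ℝ (Fin d)) 1) *
        ∫ u in Ioo (0 : ℝ) 1, u ^ ((d / 2 : ℝ) - 1) * (1 - u) ^ β * F u := by
  have : Nonempty (Fin d) := ⟨⟨0, hd⟩⟩
  rw [integral_fun_norm_addHaar volume (fun y => posPow (1 - y ^ 2) β * F (y ^ 2)),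
    finrank_euclideanSpace_fin]
  set g : ℝ → ℝ := fun u => (1 / 2) * (u ^ ((d / 2 : ℝ) - 1) * (posPow (1 - u) β * F u)) with hg
  have h1 : ∫ y in Ioi (0 : ℝ), y ^ (d - 1) • (posPow (1 - y ^ 2) β * F (y ^ 2)) =
      ∫ u in Ioi (0 : ℝ), g u := by
    rw [← integral_comp_rpow_Ioi g two_ne_zero]
    refine setIntegral_congr_fun measurableSet_Ioi fun y hy => ?_
    have hy0 : (0 : ℝ) < y := hy
    simp only [smul_eq_mul, hg, Real.rpow_two]
    have : y ^ (d - 1) = y ^ ((2 : ℝ) - 1) * (y ^ 2) ^ ((d / 2 : ℝ) - 1) := by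
      rw [← Real.rpow_two, ← Real.rpow_mul hy0.le, ← Real.rpow_add hy0, ← Real.rpow_natCast,
        Nat.cast_sub hd]
      congr 1
      push_cast
      ring
    rw [this, abs_of_pos two_pos]
    ring
  have h2 : ∫ u in Ioi (0 : ℝ), g u =
      1 / 2 * ∫ u in Ioo (0 : ℝ) 1, u ^ ((d / 2 : ℝ) - 1) * (1 - u) ^ β * F u := by
    rw [← integral_const_mul, setIntegral_eq_of_subset_of_forall_sdiff_eq_zero
      measurableSet_Ioi (Ioo_subset_Ioi_self : Ioo (0 : ℝ) 1 ⊆ Ioi 0)]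
    · refine setIntegral_congr_fun measurableSet_Ioo fun u hu => ?_
      simp only [hg]
      rw [posPow, if_pos (by linarith [hu.2])]
      ring
    · intro u hu
      have : ¬ 0 < 1 - u := fun h => hu.2 ⟨hu.1, by linarith⟩
      simp only [hg]
      rw [posPow, if_neg this]
      ring
  rw [h1, h2, nsmul_eq_mul, smul_eq_mul]
  ring

/-- The pairing of `(1 - |ξ|²)₊ ^ β` with the Fourier transform of the ball of radius `r`. -/
noncomputable def rieszBall (d : ℕ) (β r : ℝ) : ℝ :=
  ∫ ξ, posPow (1 - ‖ξ‖ ^ 2) β * (𝓕 (fun x => (ballIndicator d r x : ℂ)) ξ).re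

theorem rieszBall_eq {d : ℕ} (hd : 1 ≤ d) {β r : ℝ} (hβ : 0 ≤ β) (hr : 0 < r) :
    rieszBall d β r = d / 2 * volume.real (Metric.ball (0 : EuclideanSpace ℝ (Fin d)) 1) *
      Real.Gamma (β + 1) * √Real.pi ^ d *
        (r ^ d * besselIntegralSeries (d / 2) (d / 2 + β) (Real.pi ^ 2 * r ^ 2)) := by
  have hμ : (0 : ℝ) < d / 2 := by
    have : (1 : ℝ) ≤ d := by exact_mod_cast hd
    linarith
  rw [rieszBall]
  simp only [fourier_ballIndicator hd hr]
  rw [integral_posPow_mul_norm_sq hd β (fun u => √Real.pi ^ d * r ^ d *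
    besselSeries (d / 2) (Real.pi ^ 2 * r ^ 2 * u))]
  have h := setIntegral_betaWeight_besselSeries hμ hβ (Real.pi ^ 2 * r ^ 2)
  have : ∀ u : ℝ, u ^ ((d / 2 : ℝ) - 1) * (1 - u) ^ β * (√Real.pi ^ d * r ^ d *
      besselSeries (d / 2) (Real.pi ^ 2 * r ^ 2 * u)) = √Real.pi ^ d * r ^ d *
      (u ^ ((d / 2 : ℝ) - 1) * (1 - u) ^ β *
        besselSeries (d / 2) (u * (Real.pi ^ 2 * r ^ 2))) := fun u => by
    rw [mul_comm u (Real.pi ^ 2 * r ^ 2)]; ring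
  simp only [this]
  rw [integral_const_mul, h]
  ring

/-- With `x = π² r²` and `μ = d/2` one has `x ^ (-μ) = (π r) ^ (-d)`, and `r ^ d * min(1, (π r) ^
(-d)) ≥ π ^ (-d) * min(1, r ^ d)`. The hypothesis `d/2 ≤ β` is what makes the pairing an average of
squares. -/
theorem exists_le_rieszBall {d : ℕ} (hd : 1 ≤ d) {β : ℝ} (hβ : (d / 2 : ℝ) ≤ β) :
    ∃ c : ℝ, 0 < c ∧ ∀ r : ℝ, 0 < r → c * min 1 (r ^ d) ≤ rieszBall d β r := by
  have hd1 : (1 : ℝ) ≤ d := by exact_mod_cast hd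
  have hμ : (0 : ℝ) < d / 2 := by linarith
  have hV : 0 < volume.real (Metric.ball (0 : EuclideanSpace ℝ (Fin d)) 1) :=
    ENNReal.toReal_pos (Metric.measure_ball_pos _ _ one_pos).ne' measure_ball_lt_top.ne
  have hG : 0 < Real.Gamma (β + 1) := Real.Gamma_pos_of_pos (by linarith)
  obtain ⟨c, hc, h⟩ := exists_le_besselIntegralSeries hμ hβ
  set K := d / 2 * volume.real (Metric.ball (0 : EuclideanSpace ℝ (Fin d)) 1) *
      Real.Gamma (β + 1) * √Real.pi ^ d with hK
  have hK0 : 0 < K := by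
    have := Real.sqrt_pos.2 Real.pi_pos
    positivity
  have hpi : (1 : ℝ) ≤ Real.pi ^ d := one_le_pow₀ (by linarith [Real.pi_gt_three])
  refine ⟨K * (c / Real.pi ^ d), by positivity, fun r hr => ?_⟩
  rw [rieszBall_eq hd (by linarith) hr, ← hK, mul_assoc K]
  refine mul_le_mul_of_nonneg_left ?_ hK0.le
  have h1 := h (Real.pi ^ 2 * r ^ 2) (by positivity)
  have h2 : (Real.pi ^ 2 * r ^ 2) ^ (-(d / 2 : ℝ)) = (Real.pi ^ d * r ^ d)⁻¹ := by
    rw [← mul_pow, ← mul_pow, Real.rpow_neg (by positivity), ← Real.rpow_natCast _ 2,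
      ← Real.rpow_mul (by positivity), ← Real.rpow_natCast _ d]
    congr 2
    push_cast
    ring
  rw [h2] at h1
  refine le_trans ?_ (mul_le_mul_of_nonneg_left h1 (by positivity : 0 ≤ r ^ d))
  rw [mul_left_comm, div_mul_eq_mul_div, mul_div_assoc]
  refine mul_le_mul_of_nonneg_left ?_ hc.le
  have h3 : 0 < r ^ d := by positivity
  rw [mul_min_of_nonneg _ _ h3.le, mul_one, div_le_iff₀ (by positivity)]
  rcases le_total (r ^ d) (r ^ d * (Real.pi ^ d * r ^ d)⁻¹) with h4 | h4
  · rw [min_eq_left h4]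
    exact (min_le_right _ _).trans (le_mul_of_one_le_right h3.le hpi)
  · rw [min_eq_right h4]
    refine (min_le_left _ _).trans (le_of_eq ?_)
    field_simp

/-! ### Bochner-Riesz weights -/

theorem measurable_posPow (α : ℝ) : Measurable fun t => posPow t α :=
  Measurable.ite (measurableSet_lt measurable_const measurable_id) (by fun_prop) measurable_const

theorem posPow_nonneg (t α : ℝ) : 0 ≤ posPow t α := by
  rw [posPow]
  split_ifs with h
  · exact Real.rpow_nonneg h.le _
  · exact le_rfl

theorem integrable_posPow {d : ℕ} (hd : 1 ≤ d) {α : ℝ} (hα : -1 < α) :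
    Integrable fun ξ : EuclideanSpace ℝ (Fin d) => posPow (1 - ‖ξ‖ ^ 2) α := by
  have : Nonempty (Fin d) := ⟨⟨0, hd⟩⟩
  have hμ : (0 : ℝ) < d / 2 := by
    have : (1 : ℝ) ≤ d := by exact_mod_cast hd
    linarith
  rw [integrable_fun_norm_addHaar volume (f := fun y => posPow (1 - y ^ 2) α),
    finrank_euclideanSpace_fin]
  set g : ℝ → ℝ := fun u => (1 / 2) * (u ^ ((d / 2 : ℝ) - 1) * posPow (1 - u) α) with hg
  have hg1 : IntegrableOn g (Ioi 0) := by
    have h1 : IntegrableOn g (Ioo 0 1) := by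
      have := (integrableOn_betaWeight hμ (by linarith : 0 < α + 1)).const_mul (1 / 2)
      refine IntegrableOn.congr_fun this (fun u hu => ?_) measurableSet_Ioo
      simp only [hg]
      rw [posPow, if_pos (by linarith [hu.2]), add_sub_cancel_right]
    refine h1.of_forall_sdiff_eq_zero measurableSet_Ioi fun u hu => ?_
    have : ¬ 0 < 1 - u := fun h => hu.2 ⟨hu.1, by linarith⟩
    simp only [hg]
    rw [posPow, if_neg this]
    ring
  refine ((integrableOn_Ioi_comp_rpow_iff g two_ne_zero).2 hg1).congr_fun (fun y hy => ?_)
    measurableSet_Ioi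
  have hy0 : (0 : ℝ) < y := hy
  simp only [smul_eq_mul, hg, Real.rpow_two]
  have : y ^ (d - 1) = y ^ ((2 : ℝ) - 1) * (y ^ 2) ^ ((d / 2 : ℝ) - 1) := by
    rw [← Real.rpow_two, ← Real.rpow_mul hy0.le, ← Real.rpow_add hy0, ← Real.rpow_natCast,
      Nat.cast_sub hd]
    congr 1
    push_cast
    ring
  rw [this, abs_of_pos two_pos]
  ring

theorem one_sub_norm_inv_smul_sq {d : ℕ} {Ω : ℝ} (hΩ : 0 < Ω) (ξ : EuclideanSpace ℝ (Fin d)) :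
    1 - ‖Ω⁻¹ • ξ‖ ^ 2 = 1 - ‖ξ‖ ^ 2 / Ω ^ 2 := by
  rw [norm_smul, norm_inv, Real.norm_of_nonneg hΩ.le]
  field_simp

theorem integrable_posPow_div {d : ℕ} (hd : 1 ≤ d) {α Ω : ℝ} (hα : -1 < α) (hΩ : 0 < Ω) :
    Integrable fun ξ : EuclideanSpace ℝ (Fin d) => posPow (1 - ‖ξ‖ ^ 2 / Ω ^ 2) α := by
  have := (integrable_posPow hd hα).comp_smul (inv_ne_zero hΩ.ne')
  simpa only [one_sub_norm_inv_smul_sq hΩ] using this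

/-! ### The layer cake formula for the rearrangement -/

section Layers

variable {d : ℕ} (φ : EuclideanSpace ℝ (Fin d) → ℂ)

/-- The radius of the ball `{|φ| > t}^*`. -/
noncomputable def layerRadius (t : ℝ) : ℝ :=
  (volume.real {y | t < ‖φ y‖} / volume.real (Metric.ball (0 : EuclideanSpace ℝ (Fin d)) 1)) ^
    (1 / (d : ℝ))

/-- The distribution function is antitone, hence measurable whether or not `φ` is. -/
theorem measurable_volume_layer : Measurable fun t : ℝ => volume {y | t < ‖φ y‖} := by
  refine Antitone.measurable fun s t hst => measure_mono fun y (hy : t < _) => ?_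
  exact hst.trans_lt hy

theorem measurable_layerRadius : Measurable (layerRadius φ) :=
  ((measurable_volume_layer φ).ennreal_toReal.div_const _).pow_const _

theorem layerRadius_nonneg (t : ℝ) : 0 ≤ layerRadius φ t :=
  Real.rpow_nonneg (div_nonneg measureReal_nonneg measureReal_nonneg) _

theorem layerRadius_pow (hd : 1 ≤ d) (t : ℝ) : layerRadius φ t ^ d =
    volume.real {y | t < ‖φ y‖} / volume.real (Metric.ball (0 : EuclideanSpace ℝ (Fin d)) 1) := by
  rw [layerRadius, one_div, Real.rpow_inv_natCast_pow
    (div_nonneg measureReal_nonneg measureReal_nonneg) (by lia)]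

theorem measureReal_unitBall_pos :
    0 < volume.real (Metric.ball (0 : EuclideanSpace ℝ (Fin d)) 1) :=
  ENNReal.toReal_pos (Metric.measure_ball_pos _ _ one_pos).ne' measure_ball_lt_top.ne

variable {φ} in
-- Integrability makes the layer at height `t > 0` finite; an infinite layer would have real volume
-- `0` and so radius `0`.
theorem volume_ball_layerRadius (hd : 1 ≤ d) (hφ : Integrable φ) {t : ℝ} (ht : 0 < t) :
    volume (Metric.ball (0 : EuclideanSpace ℝ (Fin d)) (layerRadius φ t)) =
      volume {y | t < ‖φ y‖} := by
  have : Nonempty (Fin d) := ⟨⟨0, hd⟩⟩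
  have hV := measureReal_unitBall_pos (d := d)
  rw [Measure.addHaar_ball _ _ (layerRadius_nonneg φ t), finrank_euclideanSpace_fin,
    layerRadius_pow φ hd, ← ofReal_measureReal (s := Metric.ball 0 1) measure_ball_lt_top.ne,
    ← ENNReal.ofReal_mul (div_nonneg measureReal_nonneg hV.le), div_mul_cancel₀ _ hV.ne',
    ofReal_measureReal (hφ.measure_norm_gt_lt_top ht).ne]

/-- The indicator function of the ball `{|φ| > t}^*`, as a function of the point and of `t`. -/
noncomputable def layerIndicator (p : EuclideanSpace ℝ (Fin d) × ℝ) : ℝ :=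
  ballIndicator d (layerRadius φ p.2) p.1

theorem measurable_layerIndicator : Measurable (layerIndicator φ) := by
  have : layerIndicator φ =
      ({p | ‖p.1‖ < layerRadius φ p.2} : Set (EuclideanSpace ℝ (Fin d) × ℝ)).indicator
        fun _ => 1 := by
    funext p
    simp only [layerIndicator, ballIndicator, indicator, mem_ball_zero_iff, mem_ofPred_eq]
  rw [this]
  refine measurable_const.indicator (measurableSet_lt (by fun_prop) ?_)
  exact (measurable_layerRadius φ).comp measurable_snd

theorem ballIndicator_nonneg (d : ℕ) (r : ℝ) (x : EuclideanSpace ℝ (Fin d)) :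
    0 ≤ ballIndicator d r x :=
  indicator_nonneg (fun _ _ => zero_le_one) _

variable {φ} in
theorem lintegral_volume_layer (hφ : Integrable φ) :
    ∫⁻ t in Ioi (0 : ℝ), volume {y | t < ‖φ y‖} ≠ ∞ := by
  rw [← lintegral_eq_lintegral_meas_lt volume (Filter.Eventually.of_forall fun x => norm_nonneg _)
    hφ.1.norm.aemeasurable]
  exact ((hasFiniteIntegral_iff_ofReal (Filter.Eventually.of_forall fun x => norm_nonneg _)).1
    hφ.norm.2).ne

theorem layerIndicator_nonneg (p : EuclideanSpace ℝ (Fin d) × ℝ) : 0 ≤ layerIndicator φ p :=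
  ballIndicator_nonneg d _ _

theorem lintegral_ballIndicator (d : ℕ) (r : ℝ) :
    ∫⁻ x, ENNReal.ofReal (ballIndicator d r x) =
      volume (Metric.ball (0 : EuclideanSpace ℝ (Fin d)) r) := by
  rw [← lintegral_indicator_one Metric.isOpen_ball.measurableSet]
  refine lintegral_congr fun x => ?_
  simp only [ballIndicator, indicator]
  split_ifs <;> simp

variable {φ} in
-- The total mass is `∫ |{|φ| > t}| dt = ‖φ‖₁`. This justifies the Fubini exchanges for the
-- rearrangement.
theorem integrable_layerIndicator (hd : 1 ≤ d) (hφ : Integrable φ) :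
    Integrable (layerIndicator φ) (volume.prod (volume.restrict (Ioi 0))) := by
  have hm := measurable_layerIndicator φ
  refine ⟨hm.aestronglyMeasurable, ?_⟩
  rw [hasFiniteIntegral_iff_ofReal (Filter.Eventually.of_forall (layerIndicator_nonneg φ)),
    lintegral_prod_symm' _ hm.ennreal_ofReal]
  refine lt_of_eq_of_lt ?_ (lintegral_volume_layer hφ).lt_top
  refine setLIntegral_congr_fun measurableSet_Ioi fun t ht => ?_
  rw [← volume_ball_layerRadius hd hφ ht, ← lintegral_ballIndicator]
  rfl

theorem symmRearrangement_eq (x : EuclideanSpace ℝ (Fin d)) : symmRearrangement φ x =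
    ∫⁻ t in Ioi (0 : ℝ), ENNReal.ofReal (layerIndicator φ (x, t)) := by
  refine lintegral_congr fun t => ?_
  change (Metric.ball 0 (layerRadius φ t)).indicator (fun _ => (1 : ℝ≥0∞)) x =
    ENNReal.ofReal ((Metric.ball 0 (layerRadius φ t)).indicator (fun _ => (1 : ℝ)) x)
  simp only [indicator]
  split_ifs <;> simp

/-- Where the rearrangement is infinite both sides are `0`, by the default values of `toReal` and of
the Bochner integral. -/
theorem rearr_eq_integral : rearr φ = fun x =>
    ((∫ t in Ioi (0 : ℝ), layerIndicator φ (x, t) : ℝ) : ℂ) := by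
  funext x
  have hm : Measurable fun t => layerIndicator φ (x, t) :=
    (measurable_layerIndicator φ).comp measurable_prodMk_left
  have h0 : ∀ t, 0 ≤ layerIndicator φ (x, t) := fun t => layerIndicator_nonneg φ (x, t)
  rw [rearr, integral_eq_lintegral_of_nonneg_ae (Filter.Eventually.of_forall h0)
    hm.aestronglyMeasurable, symmRearrangement_eq]

theorem ballIndicator_neg (d : ℕ) (r : ℝ) (x : EuclideanSpace ℝ (Fin d)) :
    ballIndicator d r (-x) = ballIndicator d r x := by
  simp only [ballIndicator, indicator, mem_ball_zero_iff, norm_neg]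

variable {φ} in
theorem integrable_rearr (hd : 1 ≤ d) (hφ : Integrable φ) : Integrable (rearr φ) := by
  rw [rearr_eq_integral]
  exact (integrable_layerIndicator hd hφ).integral_prod_left.ofReal

theorem fourier_rearr_im (ξ : EuclideanSpace ℝ (Fin d)) : (𝓕 (rearr φ) ξ).im = 0 := by
  rw [rearr_eq_integral]
  exact fourier_im_eq_zero_of_even
    (fun x => by simp only [layerIndicator, ballIndicator_neg]) ξ

theorem fourier_layer_re (t : ℝ) (ξ : EuclideanSpace ℝ (Fin d)) :
    (𝓕 (fun x => (ballIndicator d (layerRadius φ t) x : ℂ)) ξ).re =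
      ∫ x, Real.cos (2 * Real.pi * inner ℝ x ξ) * layerIndicator φ (x, t) :=
  fourier_re_eq_integral_cos (integrable_ballIndicator d _) ξ

variable {φ} in
theorem fourier_rearr_re (hd : 1 ≤ d) (hφ : Integrable φ) (ξ : EuclideanSpace ℝ (Fin d)) :
    (𝓕 (rearr φ) ξ).re = ∫ t in Ioi (0 : ℝ),
      (𝓕 (fun x => (ballIndicator d (layerRadius φ t) x : ℂ)) ξ).re := by
  have hK := integrable_layerIndicator hd hφ
  rw [rearr_eq_integral, fourier_re_eq_integral_cos hK.integral_prod_left]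
  simp only [fourier_layer_re]
  simp only [← integral_const_mul]
  have hcos : Continuous fun p : EuclideanSpace ℝ (Fin d) × ℝ =>
      Real.cos (2 * Real.pi * inner ℝ p.1 ξ) := by fun_prop
  have hcos1 : ∀ p : EuclideanSpace ℝ (Fin d) × ℝ,
      ‖Real.cos (2 * Real.pi * inner ℝ p.1 ξ)‖ ≤ 1 := fun p => by
    rw [Real.norm_eq_abs]
    exact Real.abs_cos_le_one _
  have hint : Integrable (fun p : EuclideanSpace ℝ (Fin d) × ℝ =>
      Real.cos (2 * Real.pi * inner ℝ p.1 ξ) * layerIndicator φ p)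
      (volume.prod (volume.restrict (Ioi 0))) :=
    hK.bdd_mul (c := 1) hcos.aestronglyMeasurable (Filter.Eventually.of_forall hcos1)
  exact integral_integral_swap (f := fun x t =>
    Real.cos (2 * Real.pi * inner ℝ x ξ) * layerIndicator φ (x, t)) hint

theorem abs_fourier_ballIndicator_re_le (d : ℕ) (r : ℝ) (ξ : EuclideanSpace ℝ (Fin d)) :
    |(𝓕 (fun x => (ballIndicator d r x : ℂ)) ξ).re| ≤ ∫ x, ballIndicator d r x := by
  rw [fourier_re_eq_integral_cos (integrable_ballIndicator d r)]
  rw [← Real.norm_eq_abs]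
  refine norm_integral_le_of_norm_le (integrable_ballIndicator d r)
    (Filter.Eventually.of_forall fun x => ?_)
  rw [norm_mul, Real.norm_of_nonneg (ballIndicator_nonneg d r x)]
  exact mul_le_of_le_one_left (ballIndicator_nonneg d r x) (Real.abs_cos_le_one _)

theorem stronglyMeasurable_fourier_layer_re :
    StronglyMeasurable fun p : EuclideanSpace ℝ (Fin d) × ℝ =>
      (𝓕 (fun x => (ballIndicator d (layerRadius φ p.2) x : ℂ)) p.1).re := by
  simp only [fourier_layer_re]
  have h1 : Measurable fun q : (EuclideanSpace ℝ (Fin d) × ℝ) × EuclideanSpace ℝ (Fin d) =>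
      layerIndicator φ (q.2, q.1.2) :=
    (measurable_layerIndicator φ).comp (by fun_prop)
  have h2 : Measurable fun q : (EuclideanSpace ℝ (Fin d) × ℝ) × EuclideanSpace ℝ (Fin d) =>
      Real.cos (2 * Real.pi * inner ℝ q.2 q.1.1) := by fun_prop
  exact (h2.mul h1).stronglyMeasurable.integral_prod_right'

variable {φ} in
-- The transform of a ball is bounded by its volume, so the product of `|w|` with the volume of the
-- layer is an integrable majorant.
theorem integrable_weight_mul_fourier_layer (hd : 1 ≤ d) (hφ : Integrable φ)
    {w : EuclideanSpace ℝ (Fin d) → ℝ} (hw : Integrable w) :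
    Integrable (fun p : EuclideanSpace ℝ (Fin d) × ℝ =>
      w p.1 * (𝓕 (fun x => (ballIndicator d (layerRadius φ p.2) x : ℂ)) p.1).re)
      (volume.prod (volume.restrict (Ioi 0))) := by
  have hK := integrable_layerIndicator hd hφ
  have hdom := hw.norm.mul_prod hK.integral_prod_right
  refine hdom.mono' (hw.1.comp_fst.mul (stronglyMeasurable_fourier_layer_re φ).aestronglyMeasurable)
    (Filter.Eventually.of_forall fun p => ?_)
  rw [norm_mul]
  exact mul_le_mul_of_nonneg_left
    (abs_fourier_ballIndicator_re_le d (layerRadius φ p.2) p.1) (norm_nonneg _)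

variable {φ} in
theorem integrable_weight_mul_fourier_rearr (hd : 1 ≤ d) (hφ : Integrable φ)
    {w : EuclideanSpace ℝ (Fin d) → ℝ} (hw : Integrable w) :
    Integrable fun ξ => w ξ * (𝓕 (rearr φ) ξ).re := by
  have := (integrable_weight_mul_fourier_layer hd hφ hw).integral_prod_left
  simpa only [integral_const_mul, ← fourier_rearr_re hd hφ] using this

variable {φ} in
theorem integral_weight_mul_fourier_rearr (hd : 1 ≤ d) (hφ : Integrable φ)
    {w : EuclideanSpace ℝ (Fin d) → ℝ} (hw : Integrable w) :
    ∫ ξ, w ξ * (𝓕 (rearr φ) ξ).re = ∫ t in Ioi (0 : ℝ), ∫ ξ,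
      w ξ * (𝓕 (fun x => (ballIndicator d (layerRadius φ t) x : ℂ)) ξ).re := by
  rw [← integral_integral_swap (f := fun ξ t => w ξ *
    (𝓕 (fun x => (ballIndicator d (layerRadius φ t) x : ℂ)) ξ).re)
    (integrable_weight_mul_fourier_layer hd hφ hw)]
  simp only [integral_const_mul, ← fourier_rearr_re hd hφ]

end Layers

/-! ### Scaling in `Ω` and the lower bound for the right-hand side -/

theorem ballIndicator_zero (d : ℕ) (x : EuclideanSpace ℝ (Fin d)) : ballIndicator d 0 x = 0 := by
  simp [ballIndicator]

theorem rieszBall_zero (d : ℕ) (β : ℝ) : rieszBall d β 0 = 0 := by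
  simp [rieszBall, ballIndicator_zero, Real.fourier_eq']

theorem integral_posPow_div_mul_fourier_ballIndicator {d : ℕ} (hd : 1 ≤ d) (β : ℝ) {Ω r : ℝ}
    (hΩ : 0 < Ω) (hr : 0 ≤ r) :
    ∫ ξ, posPow (1 - ‖ξ‖ ^ 2 / Ω ^ 2) β * (𝓕 (fun x => (ballIndicator d r x : ℂ)) ξ).re =
      rieszBall d β (Ω * r) := by
  rcases hr.eq_or_lt with rfl | hr
  · rw [mul_zero, rieszBall_zero]
    simp [ballIndicator_zero, Real.fourier_eq']
  · have h := Measure.integral_comp_smul volume (fun ξ : EuclideanSpace ℝ (Fin d) =>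
      posPow (1 - ‖ξ‖ ^ 2) β * (𝓕 (fun x => (ballIndicator d (Ω * r) x : ℂ)) ξ).re) Ω⁻¹
    rw [finrank_euclideanSpace_fin, inv_pow, inv_inv, abs_of_pos (by positivity), smul_eq_mul] at h
    have hΩd : Ω ^ d ≠ 0 := by positivity
    rw [rieszBall, ← mul_right_inj' hΩd, ← h, ← integral_const_mul]
    congr 1
    funext ξ
    rw [one_sub_norm_inv_smul_sq hΩ, fourier_ballIndicator hd hr,
      fourier_ballIndicator hd (mul_pos hΩ hr), norm_smul, norm_inv, Real.norm_of_nonneg hΩ.le,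
      show Real.pi ^ 2 * (Ω * r) ^ 2 * (Ω⁻¹ * ‖ξ‖) ^ 2 = Real.pi ^ 2 * r ^ 2 * ‖ξ‖ ^ 2 by
        field_simp]
    ring

/-- The right-hand side controls the layers of `φ`. -/
theorem exists_le_integral_posPow_mul_fourier_rearr {d : ℕ} (hd : 1 ≤ d) {β : ℝ}
    (hβ : (d / 2 : ℝ) ≤ β) :
    ∃ c : ℝ, 0 < c ∧ ∀ φ : EuclideanSpace ℝ (Fin d) → ℂ, Integrable φ → ∀ Ω : ℝ, 0 < Ω →
      IntegrableOn (fun t => min 1 (Ω ^ d * volume.real {y | t < ‖φ y‖})) (Ioi 0) ∧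
      c * ∫ t in Ioi (0 : ℝ), min 1 (Ω ^ d * volume.real {y | t < ‖φ y‖}) ≤
        ∫ ξ, posPow (1 - ‖ξ‖ ^ 2 / Ω ^ 2) β * (𝓕 (rearr φ) ξ).re := by
  obtain ⟨c, hc, h⟩ := exists_le_rieszBall hd hβ
  set V := volume.real (Metric.ball (0 : EuclideanSpace ℝ (Fin d)) 1) with hV
  have hV0 : 0 < V := measureReal_unitBall_pos
  have hβ1 : -1 < β := by
    have := (Nat.cast_nonneg d : (0 : ℝ) ≤ d)
    linarith
  -- The factor `min 1 V⁻¹` passes from `(Ω r) ^ d` to `Ω ^ d |E_t| = V (Ω r) ^ d`, with `V` the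
  -- volume of the unit ball.
  refine ⟨c * min 1 V⁻¹, by positivity, fun φ hφ Ω hΩ => ?_⟩
  have hm := (measurable_volume_layer φ).ennreal_toReal
  have hint : IntegrableOn (fun t => min 1 (Ω ^ d * volume.real {y | t < ‖φ y‖})) (Ioi 0) := by
    have h1 := (integrable_toReal_of_lintegral_ne_top (measurable_volume_layer φ).aemeasurable
      (lintegral_volume_layer hφ)).const_mul (Ω ^ d)
    refine h1.mono' (measurable_const.min (hm.const_mul _)).aestronglyMeasurable
      (Filter.Eventually.of_forall fun t => ?_)
    rw [Real.norm_of_nonneg (le_min zero_le_one (mul_nonneg (by positivity) measureReal_nonneg))]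
    exact min_le_right _ _
  refine ⟨hint, ?_⟩
  have hw := integrable_posPow_div hd hβ1 hΩ
  rw [integral_weight_mul_fourier_rearr hd hφ hw]
  have hI := (integrable_weight_mul_fourier_layer hd hφ hw).integral_prod_right
  simp only [integral_posPow_div_mul_fourier_ballIndicator hd β hΩ (layerRadius_nonneg φ _)]
    at hI ⊢
  rw [← integral_const_mul]
  refine integral_mono (hint.const_mul _) hI fun t => ?_
  have hmt : 0 ≤ Ω ^ d * volume.real {y | t < ‖φ y‖} :=
    mul_nonneg (by positivity) measureReal_nonneg
  have hpow : (Ω * layerRadius φ t) ^ d = V⁻¹ * (Ω ^ d * volume.real {y | t < ‖φ y‖}) := by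
    rw [mul_pow, layerRadius_pow φ hd]; ring
  have hmin : min 1 V⁻¹ * min 1 (Ω ^ d * volume.real {y | t < ‖φ y‖}) ≤
      min 1 ((Ω * layerRadius φ t) ^ d) := by
    rw [hpow]
    refine le_min ?_ ?_
    · exact mul_le_one₀ (min_le_left _ _) (le_min zero_le_one hmt) (min_le_left _ _)
    · exact mul_le_mul (min_le_right _ _) (min_le_right _ _) (le_min zero_le_one hmt)
        (by positivity)
  change c * min 1 V⁻¹ * min 1 _ ≤ _
  rw [mul_assoc]
  rcases (layerRadius_nonneg φ t).eq_or_lt with h0 | h0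
  · rw [← h0, mul_zero, rieszBall_zero]
    rw [← h0, mul_zero, zero_pow (by lia), min_eq_right zero_le_one] at hmin
    exact mul_nonpos_of_nonneg_of_nonpos hc.le hmin
  · exact (mul_le_mul_of_nonneg_left hmin hc.le).trans (h _ (mul_pos hΩ h0))

/-! ### Plancherel's theorem on `L¹ ∩ L²` -/

theorem continuous_fourier {d : ℕ} {f : EuclideanSpace ℝ (Fin d) → ℂ} (hf : Integrable f) :
    Continuous (𝓕 f) :=
  VectorFourier.fourierIntegral_continuous Real.continuous_fourierChar (innerSL ℝ).continuous₂ hf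

open SchwartzMap in
-- The `L²` transform, defined by extension, agrees with the integral: tested against a smooth
-- compactly supported function, each lets the transform move onto the test function.
theorem fourier_toLp_ae_eq {d : ℕ} {f : EuclideanSpace ℝ (Fin d) → ℂ} (hf : Integrable f)
    (hf2 : MemLp f 2) : (𝓕 (hf2.toLp f) : Lp ℂ 2 (volume : Measure (EuclideanSpace ℝ (Fin d)))) =ᵐ[volume] 𝓕 f := by
  set F : Lp ℂ 2 (volume : Measure (EuclideanSpace ℝ (Fin d))) := 𝓕 (hf2.toLp f) with hF
  refine ae_eq_of_integral_contDiff_smul_eq ((Lp.memLp F).locallyIntegrable (by norm_num))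
    (continuous_fourier hf).locallyIntegrable fun g hg hgs => ?_
  have hgs' : HasCompactSupport fun x => (g x : ℂ) :=
    hgs.comp_left (g := fun y : ℝ => (y : ℂ)) Complex.ofReal_zero
  have hg' : ContDiff ℝ (⊤ : ℕ∞) fun x => (g x : ℂ) := Complex.ofRealCLM.contDiff.comp hg
  set G : 𝓢(EuclideanSpace ℝ (Fin d), ℂ) := hgs'.toSchwartzMap hg' with hG
  have h1 := congrArg (fun T => T G) (Lp.fourier_toTemperedDistribution_eq (hf2.toLp f))
  simp only [TemperedDistribution.fourier_apply, Lp.toTemperedDistribution_apply] at h1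
  have h2 : ∫ x, (𝓕 G) x • (hf2.toLp f : Lp ℂ 2 (volume : Measure (EuclideanSpace ℝ (Fin d)))) x =
      ∫ x, (𝓕 G) x • f x := by
    refine integral_congr_ae (hf2.coeFn_toLp.mono fun x hx => ?_)
    simp only [hx]
  have h3 : ∫ x, (𝓕 G) x • f x = ∫ x, G x • 𝓕 f x := by
    have := VectorFourier.integral_fourierIntegral_smul_eq_flip
      (L := innerₗ (EuclideanSpace ℝ (Fin d))) (μ := volume) (ν := volume)
      Real.continuous_fourierChar continuous_inner G.integrable hf
    rw [flip_innerₗ] at this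
    exact this
  have hGg : ∀ x, G x = (g x : ℂ) := fun x => rfl
  simp only [hGg] at h1 h3
  simp only [← Complex.coe_smul]
  rw [← hF] at h1
  rw [← h1, h2, h3]

theorem eLpNorm_fourier_two {d : ℕ} {f : EuclideanSpace ℝ (Fin d) → ℂ} (hf : Integrable f)
    (hf2 : MemLp f 2) : eLpNorm (𝓕 f) 2 = eLpNorm f 2 := by
  rw [← eLpNorm_congr_ae (fourier_toLp_ae_eq hf hf2), ← eLpNorm_congr_ae hf2.coeFn_toLp,
    ← ENNReal.toReal_eq_toReal_iff' (Lp.eLpNorm_lt_top _).ne (Lp.eLpNorm_lt_top _).ne]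
  exact Lp.norm_fourier_eq (hf2.toLp f)

/-! ### Weighted bounds for the Fourier transform -/

theorem ennreal_mul_le_mul {a b a' b' : ℝ≥0∞} (h : a ≤ a') (h' : b ≤ b') : a * b ≤ a' * b' :=
  mul_le_mul' h h'

theorem eLpNorm_comp_inv_smul {d : ℕ} {ψ : EuclideanSpace ℝ (Fin d) → ℂ} {p : ℝ≥0∞}
    (hψ : AEStronglyMeasurable ψ) (hp : p ≠ ∞) {Ω : ℝ} (hΩ : 0 < Ω) :
    eLpNorm (fun ξ => ψ (Ω⁻¹ • ξ)) p = ENNReal.ofReal (Ω ^ d) ^ (1 / p).toReal * eLpNorm ψ p := by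
  have hmap := Measure.map_addHaar_smul (volume : Measure (EuclideanSpace ℝ (Fin d)))
    (inv_ne_zero hΩ.ne')
  rw [finrank_euclideanSpace_fin, inv_pow, inv_inv, abs_of_pos (by positivity)] at hmap
  have h := eLpNorm_map_measure (p := p) (μ := (volume : Measure (EuclideanSpace ℝ (Fin d))))
    (f := fun ξ => Ω⁻¹ • ξ) (g := ψ) (by rw [hmap]; exact hψ.smul_measure _) (by fun_prop)
  rw [hmap, eLpNorm_smul_measure_of_ne_top hp, smul_eq_mul] at h
  rw [h]
  rfl

theorem aestronglyMeasurable_comp_inv_smul {d : ℕ} {ψ : EuclideanSpace ℝ (Fin d) → ℂ}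
    (hψ : AEStronglyMeasurable ψ) {Ω : ℝ} (hΩ : 0 < Ω) :
    AEStronglyMeasurable fun ξ => ψ (Ω⁻¹ • ξ) := by
  refine AEStronglyMeasurable.comp_quasiMeasurePreserving hψ
    ⟨by fun_prop, ?_⟩
  rw [Measure.map_addHaar_smul _ (inv_ne_zero hΩ.ne')]
  exact Measure.smul_absolutelyContinuous

theorem lintegral_mul_le_of_le_lintegral {X Y : Type*} [MeasurableSpace X] [MeasurableSpace Y]
    {μ : Measure X} {ν : Measure Y} [SFinite μ] [SFinite ν] {F w : X → ℝ≥0∞} {g : X × Y → ℝ≥0∞}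
    (hg : Measurable g) (hw : AEMeasurable w μ) (h : ∀ x, F x ≤ ∫⁻ y, g (x, y) ∂ν) :
    ∫⁻ x, F x * w x ∂μ ≤ ∫⁻ y, ∫⁻ x, g (x, y) * w x ∂μ ∂ν := by
  rw [← lintegral_lintegral_swap (f := fun x y => g (x, y) * w x)
    (hg.aemeasurable.mul hw.comp_fst)]
  refine lintegral_mono fun x => ?_
  have hgx : Measurable fun y => g (x, y) := hg.comp measurable_prodMk_left
  rw [lintegral_mul_const _ hgx]
  exact ennreal_mul_le_mul (h x) le_rfl

theorem enorm_circle_smul (c : Circle) (z : ℂ) : ‖c • z‖ₑ = ‖z‖ₑ := by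
  rw [← ofReal_norm, Circle.norm_smul, ofReal_norm]

theorem lintegral_enorm_fourier_mul_le_one {d : ℕ} (f : EuclideanSpace ℝ (Fin d) → ℂ)
    {ψ : EuclideanSpace ℝ (Fin d) → ℂ} (hψ : AEStronglyMeasurable ψ) :
    ∫⁻ ξ, ‖𝓕 f ξ‖ₑ * ‖ψ ξ‖ₑ ≤ eLpNorm f 1 * eLpNorm ψ 1 := by
  have h : ∀ ξ, ‖𝓕 f ξ‖ₑ ≤ eLpNorm f 1 := fun ξ => by
    rw [Real.fourier_eq, eLpNorm_one_eq_lintegral_enorm]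
    refine (enorm_integral_le_lintegral_enorm _).trans (lintegral_mono fun x => ?_)
    exact (enorm_circle_smul (Real.fourierChar (-inner ℝ x ξ)) (f x)).le
  calc ∫⁻ ξ, ‖𝓕 f ξ‖ₑ * ‖ψ ξ‖ₑ ≤ ∫⁻ ξ, eLpNorm f 1 * ‖ψ ξ‖ₑ :=
        lintegral_mono fun ξ => by exact ennreal_mul_le_mul (h ξ) le_rfl
    _ ≤ _ := by
      rw [lintegral_const_mul'' _ hψ.enorm, ← eLpNorm_one_eq_lintegral_enorm (f := ψ)]

theorem lintegral_enorm_fourier_mul_le_two {d : ℕ} {f ψ : EuclideanSpace ℝ (Fin d) → ℂ}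
    (hf : Integrable f) (hf2 : MemLp f 2) (hψ : AEStronglyMeasurable ψ) :
    ∫⁻ ξ, ‖𝓕 f ξ‖ₑ * ‖ψ ξ‖ₑ ≤ eLpNorm f 2 * eLpNorm ψ 2 := by
  rw [← eLpNorm_fourier_two hf hf2]
  refine le_trans (le_of_eq ?_) (eLpNorm_smul_le_mul_eLpNorm (r := 1) hψ
    (continuous_fourier hf).aestronglyMeasurable)
  rw [eLpNorm_one_eq_lintegral_enorm]
  simp only [Pi.smul_apply', smul_eq_mul, enorm_mul]

/-! ### The layer cake formula for a complex function -/

section Phase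

variable {d : ℕ} (φ : EuclideanSpace ℝ (Fin d) → ℂ)

/-- The phase of `φ` on `{|φ| > t}`, extended by zero. -/
noncomputable def phaseLayer (p : EuclideanSpace ℝ (Fin d) × ℝ) : ℂ :=
  if p.2 < ‖φ p.1‖ then φ p.1 / ‖φ p.1‖ else 0

variable {φ}

theorem measurable_phaseLayer (hφ : Measurable φ) : Measurable (phaseLayer φ) :=
  Measurable.ite (measurableSet_lt measurable_snd (hφ.comp measurable_fst).norm)
    ((hφ.comp measurable_fst).div (hφ.comp measurable_fst).norm.complex_ofReal) measurable_const

theorem norm_phaseLayer_le (p : EuclideanSpace ℝ (Fin d) × ℝ) :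
    ‖phaseLayer φ p‖ ≤ ({q | q.2 < ‖φ q.1‖} : Set (EuclideanSpace ℝ (Fin d) × ℝ)).indicator
      (fun _ => (1 : ℝ)) p := by
  simp only [phaseLayer, indicator, mem_ofPred_eq]
  split_ifs
  · rw [norm_div, Complex.norm_real, norm_norm]
    exact div_self_le_one _
  · simp

theorem setIntegral_phaseLayer (x : EuclideanSpace ℝ (Fin d)) :
    ∫ t in Ioi (0 : ℝ), phaseLayer φ (x, t) = φ x := by
  have : ∀ t ∈ Ioi (0 : ℝ), phaseLayer φ (x, t) =
      (Iio ‖φ x‖).indicator (fun _ => φ x / ‖φ x‖) t := fun t _ => by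
    simp only [phaseLayer, indicator, mem_Iio]
  rw [setIntegral_congr_fun measurableSet_Ioi this, setIntegral_indicator measurableSet_Iio,
    Ioi_inter_Iio, setIntegral_const, Real.volume_real_Ioo_of_le (norm_nonneg _), sub_zero,
    Complex.real_smul]
  rcases eq_or_ne (φ x) 0 with h | h
  · simp [h]
  · have h' : (‖φ x‖ : ℂ) ≠ 0 := by simpa using h
    field_simp

theorem integrable_phaseLayer (hφ : Measurable φ) (hφ1 : Integrable φ) :
    Integrable (phaseLayer φ) (volume.prod (volume.restrict (Ioi 0))) := by
  have hA : MeasurableSet ({q | q.2 < ‖φ q.1‖} : Set (EuclideanSpace ℝ (Fin d) × ℝ)) :=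
    measurableSet_lt measurable_snd (hφ.comp measurable_fst).norm
  have hfin : (volume.prod (volume.restrict (Ioi (0 : ℝ))))
      ({q | q.2 < ‖φ q.1‖} : Set (EuclideanSpace ℝ (Fin d) × ℝ)) ≠ ∞ := by
    rw [Measure.prod_apply_symm hA]
    exact lintegral_volume_layer hφ1
  exact ((integrable_indicator_iff hA).2 (integrableOn_const hfin)).mono'
    (measurable_phaseLayer hφ).aestronglyMeasurable (Filter.Eventually.of_forall norm_phaseLayer_le)

/-- By Fubini the transform of `φ` is the integral of the transforms of its layers. -/
theorem enorm_fourier_le_lintegral_phaseLayer (hφ : Measurable φ) (hφ1 : Integrable φ)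
    (ξ : EuclideanSpace ℝ (Fin d)) :
    ‖𝓕 φ ξ‖ₑ ≤ ∫⁻ t in Ioi (0 : ℝ), ‖𝓕 (fun x => phaseLayer φ (x, t)) ξ‖ₑ := by
  have hexp : ∀ p : EuclideanSpace ℝ (Fin d) × ℝ,
      ‖Complex.exp (↑(-2 * Real.pi * inner ℝ p.1 ξ) * Complex.I)‖ ≤ 1 := fun p => by
    rw [Complex.norm_exp_ofReal_mul_I]
  have hint : Integrable (fun p : EuclideanSpace ℝ (Fin d) × ℝ =>
      Complex.exp (↑(-2 * Real.pi * inner ℝ p.1 ξ) * Complex.I) * phaseLayer φ p)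
      (volume.prod (volume.restrict (Ioi 0))) :=
    (integrable_phaseLayer hφ hφ1).bdd_mul (c := 1)
      (Continuous.aestronglyMeasurable (by fun_prop)) (Filter.Eventually.of_forall hexp)
  have h : 𝓕 φ ξ = ∫ t in Ioi (0 : ℝ), 𝓕 (fun x => phaseLayer φ (x, t)) ξ := by
    simp only [Real.fourier_eq', smul_eq_mul]
    rw [← integral_integral_swap (f := fun x t =>
      Complex.exp (↑(-2 * Real.pi * inner ℝ x ξ) * Complex.I) * phaseLayer φ (x, t)) hint]
    simp only [integral_const_mul, setIntegral_phaseLayer]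
  rw [h]
  exact enorm_integral_le_lintegral_enorm _

theorem measurable_fourier_phaseLayer (hφ : Measurable φ) :
    Measurable fun p : EuclideanSpace ℝ (Fin d) × ℝ =>
      ‖𝓕 (fun x => phaseLayer φ (x, p.2)) p.1‖ₑ := by
  simp only [Real.fourier_eq', smul_eq_mul]
  have h1 : Measurable fun q : (EuclideanSpace ℝ (Fin d) × ℝ) × EuclideanSpace ℝ (Fin d) =>
      phaseLayer φ (q.2, q.1.2) :=
    (measurable_phaseLayer hφ).comp (by fun_prop)
  have h2 : Measurable fun q : (EuclideanSpace ℝ (Fin d) × ℝ) × EuclideanSpace ℝ (Fin d) =>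
      Complex.exp (↑(-2 * Real.pi * inner ℝ q.2 q.1.1) * Complex.I) := by fun_prop
  exact (h2.mul h1).stronglyMeasurable.integral_prod_right'.measurable.enorm

theorem lintegral_enorm_fourier_mul_le_layers (hφ : Measurable φ) (hφ1 : Integrable φ)
    {ψ : EuclideanSpace ℝ (Fin d) → ℂ} (hψ : AEStronglyMeasurable ψ) :
    ∫⁻ ξ, ‖𝓕 φ ξ‖ₑ * ‖ψ ξ‖ₑ ≤ ∫⁻ t in Ioi (0 : ℝ), ∫⁻ ξ,
      ‖𝓕 (fun x => phaseLayer φ (x, t)) ξ‖ₑ * ‖ψ ξ‖ₑ := by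
  exact lintegral_mul_le_of_le_lintegral (measurable_fourier_phaseLayer hφ) hψ.enorm
    (enorm_fourier_le_lintegral_phaseLayer hφ hφ1)

theorem memLp_phaseLayer (hφ : Measurable φ) (hφ1 : Integrable φ) {t : ℝ} (ht : 0 < t)
    {p : ℝ≥0∞} (hp0 : p ≠ 0) (hp : p ≠ ∞) :
    MemLp (fun x => phaseLayer φ (x, t)) p ∧
      eLpNorm (fun x => phaseLayer φ (x, t)) p ≤ volume {x | t < ‖φ x‖} ^ (1 / p.toReal) := by
  have hA : MeasurableSet {x | t < ‖φ x‖} := measurableSet_lt measurable_const hφ.norm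
  have hle : ∀ x, ‖phaseLayer φ (x, t)‖ ≤ ‖{x | t < ‖φ x‖}.indicator (fun _ => (1 : ℝ)) x‖ :=
    fun x => (norm_phaseLayer_le (x, t)).trans (le_abs_self _)
  constructor
  · exact (memLp_indicator_const p hA (1 : ℝ) (Or.inr (hφ1.measure_norm_gt_lt_top ht).ne)).mono
      ((measurable_phaseLayer hφ).comp measurable_prodMk_right).aestronglyMeasurable
      (Filter.Eventually.of_forall hle)
  · refine (eLpNorm_mono hle).trans (le_of_eq ?_)
    rw [eLpNorm_indicator_const hA hp0 hp, enorm_one, one_mul]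

/-- With `u = Ω ^ d |E_t|`, the `L²` bound `M u ^ (1/2)` is used when `u ≥ 1` and the `L¹` bound `M
u` when `u ≤ 1`. The factor `(1 + U) ^ (1/2)` absorbs `u ^ (1/2)` in the first case and is at least
`1` in the second. -/
theorem lintegral_enorm_fourier_phaseLayer_mul_le (hφ : Measurable φ) (hφ1 : Integrable φ)
    {ψ : EuclideanSpace ℝ (Fin d) → ℂ} (hψ : AEStronglyMeasurable ψ) {Ω t : ℝ} (hΩ : 0 < Ω)
    (ht : 0 < t) {M U : ℝ} (hM : 0 ≤ M) (hM1 : eLpNorm ψ 1 ≤ ENNReal.ofReal M)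
    (hM2 : eLpNorm ψ 2 ≤ ENNReal.ofReal M) (hU : Ω ^ d * volume.real {x | t < ‖φ x‖} ≤ U) :
    ∫⁻ ξ, ‖𝓕 (fun x => phaseLayer φ (x, t)) ξ‖ₑ * ‖ψ (Ω⁻¹ • ξ)‖ₑ ≤
      ENNReal.ofReal (M * (1 + U) ^ (1 / 2 : ℝ) *
        min 1 (Ω ^ d * volume.real {x | t < ‖φ x‖})) := by
  have hfin : volume {x | t < ‖φ x‖} ≠ ∞ := (hφ1.measure_norm_gt_lt_top ht).ne
  set m := volume.real {x | t < ‖φ x‖} with hm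
  have hm0 : 0 ≤ m := measureReal_nonneg
  have hvol : volume {x | t < ‖φ x‖} = ENNReal.ofReal m := (ofReal_measureReal hfin).symm
  have hΩd : 0 < Ω ^ d := by positivity
  have hu0 : 0 ≤ Ω ^ d * m := by positivity
  have hψΩ := aestronglyMeasurable_comp_inv_smul hψ hΩ
  obtain ⟨hL1, hN1⟩ := memLp_phaseLayer (p := 1) hφ hφ1 ht one_ne_zero ENNReal.one_ne_top
  obtain ⟨hL2, hN2⟩ := memLp_phaseLayer (p := 2) hφ hφ1 ht two_ne_zero ENNReal.ofNat_ne_top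
  have hU1 : 1 ≤ (1 + U) ^ (1 / 2 : ℝ) := Real.one_le_rpow (by linarith) (by norm_num)
  rcases le_total 1 (Ω ^ d * m) with h | h
  · refine (lintegral_enorm_fourier_mul_le_two (memLp_one_iff_integrable.1 hL1) hL2 hψΩ).trans ?_
    rw [eLpNorm_comp_inv_smul hψ ENNReal.ofNat_ne_top hΩ, min_eq_left h, mul_one]
    have e : (1 / (2 : ℝ≥0∞)).toReal = 1 / 2 := by simp
    have e' : (2 : ℝ≥0∞).toReal = 2 := by simp
    rw [e', hvol] at hN2
    rw [e]
    calc eLpNorm (fun x => phaseLayer φ (x, t)) 2 volume *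
          (ENNReal.ofReal (Ω ^ d) ^ (1 / 2 : ℝ) * eLpNorm ψ 2 volume)
        ≤ ENNReal.ofReal m ^ (1 / 2 : ℝ) *
          (ENNReal.ofReal (Ω ^ d) ^ (1 / 2 : ℝ) * ENNReal.ofReal M) :=
          ennreal_mul_le_mul hN2 (ennreal_mul_le_mul le_rfl hM2)
      _ = ENNReal.ofReal (M * (Ω ^ d * m) ^ (1 / 2 : ℝ)) := by
        rw [ENNReal.ofReal_rpow_of_nonneg hm0 (by norm_num),
          ENNReal.ofReal_rpow_of_nonneg hΩd.le (by norm_num), ← ENNReal.ofReal_mul (by positivity),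
          ← ENNReal.ofReal_mul (by positivity), Real.mul_rpow hΩd.le hm0]
        ring_nf
      _ ≤ _ := by
        refine ENNReal.ofReal_le_ofReal (mul_le_mul_of_nonneg_left ?_ hM)
        exact Real.rpow_le_rpow hu0 (by linarith) (by norm_num)
  · refine (lintegral_enorm_fourier_mul_le_one _ hψΩ).trans ?_
    rw [eLpNorm_comp_inv_smul hψ ENNReal.one_ne_top hΩ, min_eq_right h]
    simp only [ENNReal.toReal_one, div_one, ENNReal.rpow_one, hvol] at hN1 ⊢
    calc eLpNorm (fun x => phaseLayer φ (x, t)) 1 volume *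
          (ENNReal.ofReal (Ω ^ d) * eLpNorm ψ 1 volume)
        ≤ ENNReal.ofReal m * (ENNReal.ofReal (Ω ^ d) * ENNReal.ofReal M) :=
          ennreal_mul_le_mul hN1 (ennreal_mul_le_mul le_rfl hM1)
      _ = ENNReal.ofReal (M * (Ω ^ d * m)) := by
        rw [← ENNReal.ofReal_mul (by positivity), ← ENNReal.ofReal_mul (by positivity)]
        ring_nf
      _ ≤ _ := by
        refine ENNReal.ofReal_le_ofReal (mul_le_mul_of_nonneg_right ?_ hu0)
        exact le_mul_of_one_le_right hM hU1

end Phase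

/-! ### Integrating the layers and comparing both sides -/

theorem volume_layer_le {d : ℕ} {φ : EuclideanSpace ℝ (Fin d) → ℂ} {S t : ℝ} (hS : 0 < S)
    (h : volume (Function.support φ) = ENNReal.ofReal S) (ht : 0 < t) :
    volume.real {x | t < ‖φ x‖} ≤ S := by
  have hsub : {x | t < ‖φ x‖} ⊆ Function.support φ := fun x (hx : t < ‖φ x‖) =>
    norm_pos_iff.1 (ht.trans hx)
  refine (measureReal_mono hsub (by rw [h]; exact ENNReal.ofReal_ne_top)).trans (le_of_eq ?_)
  rw [measureReal_def, h, ENNReal.toReal_ofReal hS.le]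

theorem lintegral_enorm_fourier_mul_le {d : ℕ} {φ ψ : EuclideanSpace ℝ (Fin d) → ℂ}
    (hφ1 : Integrable φ) (hψ : AEStronglyMeasurable ψ) {Ω S : ℝ} (hΩ : 0 < Ω) (hS : 0 < S)
    (hsupp : volume (Function.support φ) = ENNReal.ofReal S)
    {M : ℝ} (hM : 0 ≤ M) (hM1 : eLpNorm ψ 1 ≤ ENNReal.ofReal M)
    (hM2 : eLpNorm ψ 2 ≤ ENNReal.ofReal M) :
    ∫⁻ ξ, ‖𝓕 φ ξ‖ₑ * ‖ψ (Ω⁻¹ • ξ)‖ₑ ≤ ∫⁻ t in Ioi (0 : ℝ),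
      ENNReal.ofReal (M * (1 + Ω ^ d * S) ^ (1 / 2 : ℝ) *
        min 1 (Ω ^ d * volume.real {x | t < ‖φ x‖})) := by
  -- Joint measurability of the layers needs a measurable representative; the transform and the
  -- volumes of the layers do not change.
  set φ' := hφ1.1.mk φ with hφ'
  have hae : φ =ᵐ[volume] φ' := hφ1.1.ae_eq_mk
  have hmeas : Measurable φ' := hφ1.1.stronglyMeasurable_mk.measurable
  have hlev : ∀ t : ℝ, volume.real {x | t < ‖φ' x‖} = volume.real {x | t < ‖φ x‖} := fun t => by
    refine measureReal_congr (hae.mono fun x hx => ?_)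
    exact propext (by change t < ‖φ' x‖ ↔ t < ‖φ x‖; rw [hx])
  have hint : Integrable φ' := hφ1.congr hae
  simp only [Real.fourier_congr_ae hae]
  refine (lintegral_enorm_fourier_mul_le_layers hmeas hint
    (aestronglyMeasurable_comp_inv_smul hψ hΩ)).trans ?_
  refine setLIntegral_mono' measurableSet_Ioi fun t ht => ?_
  rw [← hlev]
  refine lintegral_enorm_fourier_phaseLayer_mul_le hmeas hint hψ hΩ ht hM hM1 hM2 ?_
  rw [hlev]
  exact mul_le_mul_of_nonneg_left (volume_layer_le hS hsupp ht) (by positivity)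

theorem exists_integral_fourier_mul_le {d : ℕ} (hd : 1 ≤ d) {β : ℝ} (hβ : (d / 2 : ℝ) ≤ β) :
    ∃ C : ℝ, 0 < C ∧ ∀ ψ : EuclideanSpace ℝ (Fin d) → ℂ, AEStronglyMeasurable ψ →
      ∀ M : ℝ, 0 ≤ M → eLpNorm ψ 1 ≤ ENNReal.ofReal M → eLpNorm ψ 2 ≤ ENNReal.ofReal M →
      ∀ S Ω : ℝ, 0 < S → 0 < Ω →
      ∀ φ : EuclideanSpace ℝ (Fin d) → ℂ, Integrable φ →
        volume (Function.support φ) = ENNReal.ofReal S →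
        Integrable (fun ξ => ‖𝓕 φ ξ‖ * ‖ψ (Ω⁻¹ • ξ)‖) ∧
        ∫ ξ, ‖𝓕 φ ξ‖ * ‖ψ (Ω⁻¹ • ξ)‖ ≤ C * M * (1 + Ω ^ d * S) ^ ((d : ℝ) / 2) *
          ∫ ξ, posPow (1 - ‖ξ‖ ^ 2 / Ω ^ 2) β * (𝓕 (rearr φ) ξ).re := by
  obtain ⟨c, hc, h⟩ := exists_le_integral_posPow_mul_fourier_rearr hd hβ
  refine ⟨1 / c, by positivity, fun ψ hψ M hM hM1 hM2 S Ω hS hΩ φ hφ hsupp => ?_⟩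
  obtain ⟨hI, hle⟩ := h φ hφ Ω hΩ
  set I := ∫ t in Ioi (0 : ℝ), min 1 (Ω ^ d * volume.real {x | t < ‖φ x‖}) with hIdef
  have hmin0 : ∀ t : ℝ, 0 ≤ min 1 (Ω ^ d * volume.real {x | t < ‖φ x‖}) := fun t =>
    le_min zero_le_one (mul_nonneg (by positivity) measureReal_nonneg)
  have hI0 : 0 ≤ I := integral_nonneg hmin0
  have hU : 1 ≤ 1 + Ω ^ d * S := by
    have : 0 ≤ Ω ^ d * S := by positivity
    linarith
  set B := M * (1 + Ω ^ d * S) ^ (1 / 2 : ℝ) with hB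
  have hB0 : 0 ≤ B := mul_nonneg hM (Real.rpow_nonneg (by linarith) _)
  have hlint : ∫⁻ ξ, ‖‖𝓕 φ ξ‖ * ‖ψ (Ω⁻¹ • ξ)‖‖ₑ ≤ ENNReal.ofReal (B * I) := by
    have h1 := lintegral_enorm_fourier_mul_le hφ hψ hΩ hS hsupp hM hM1 hM2
    rw [← hB, ← ofReal_integral_eq_lintegral_ofReal (hI.const_mul B)
      (Filter.Eventually.of_forall fun t => mul_nonneg hB0 (hmin0 t)), integral_const_mul] at h1
    simpa only [enorm_mul, enorm_norm] using h1
  have hmeas : AEStronglyMeasurable fun ξ => ‖𝓕 φ ξ‖ * ‖ψ (Ω⁻¹ • ξ)‖ :=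
    (continuous_fourier hφ).norm.aestronglyMeasurable.mul
      (aestronglyMeasurable_comp_inv_smul hψ hΩ).norm
  refine ⟨⟨hmeas, hlint.trans_lt ENNReal.ofReal_lt_top⟩, ?_⟩
  have hnn : ∀ ξ, 0 ≤ ‖𝓕 φ ξ‖ * ‖ψ (Ω⁻¹ • ξ)‖ := fun ξ => by positivity
  have h2 : ∫ ξ, ‖𝓕 φ ξ‖ * ‖ψ (Ω⁻¹ • ξ)‖ ≤ B * I := by
    rw [integral_eq_lintegral_of_nonneg_ae (Filter.Eventually.of_forall hnn) hmeas]
    refine ENNReal.toReal_le_of_le_ofReal (mul_nonneg hB0 hI0) (le_trans (le_of_eq ?_) hlint)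
    exact lintegral_congr fun ξ => (Real.enorm_of_nonneg (hnn ξ)).symm
  set R := ∫ ξ, posPow (1 - ‖ξ‖ ^ 2 / Ω ^ 2) β * (𝓕 (rearr φ) ξ).re with hR
  have hIR : I ≤ 1 / c * R := by
    rw [one_div, inv_mul_eq_div, le_div_iff₀ hc]
    linarith
  -- The argument yields exponent `1/2`; the base is at least `1` and `d ≥ 1`, so `d/2` follows.
  have hpow : (1 + Ω ^ d * S) ^ (1 / 2 : ℝ) ≤ (1 + Ω ^ d * S) ^ ((d : ℝ) / 2) := by
    refine Real.rpow_le_rpow_of_exponent_le hU ?_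
    have : (1 : ℝ) ≤ d := by exact_mod_cast hd
    linarith
  have hR0 : 0 ≤ 1 / c * R := hI0.trans hIR
  calc _ ≤ B * I := h2
    _ ≤ M * (1 + Ω ^ d * S) ^ ((d : ℝ) / 2) * (1 / c * R) := by
      exact mul_le_mul (mul_le_mul_of_nonneg_left hpow hM) hIR hI0
        (mul_nonneg hM (Real.rpow_nonneg (by linarith) _))
    _ = _ := by ring

/-! ### The Bochner-Riesz weights belong to `L¹ ∩ L²` -/

/-- The square of the weight is the weight of exponent `2 α`, integrable once `2 α > -1`; hence the
threshold `-1/2`. -/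
theorem memLp_posPow {d : ℕ} (hd : 1 ≤ d) {α : ℝ} (hα : -(1 / 2) < α) :
    MemLp (fun ξ : EuclideanSpace ℝ (Fin d) => (posPow (1 - ‖ξ‖ ^ 2) α : ℂ)) 1 ∧
    MemLp (fun ξ : EuclideanSpace ℝ (Fin d) => (posPow (1 - ‖ξ‖ ^ 2) α : ℂ)) 2 := by
  have hm : Measurable fun ξ : EuclideanSpace ℝ (Fin d) => (posPow (1 - ‖ξ‖ ^ 2) α : ℂ) :=
    ((measurable_posPow α).comp (by fun_prop : Measurable
      fun ξ : EuclideanSpace ℝ (Fin d) => 1 - ‖ξ‖ ^ 2)).complex_ofReal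
  constructor
  · exact memLp_one_iff_integrable.2 (integrable_posPow hd (by linarith)).ofReal
  · rw [memLp_two_iff_integrable_sq_norm hm.aestronglyMeasurable]
    have h := integrable_posPow hd (by linarith : -1 < α * 2)
    refine h.congr (Filter.Eventually.of_forall fun ξ => ?_)
    simp only [Complex.norm_real, Real.norm_of_nonneg (posPow_nonneg _ _)]
    rw [posPow, posPow]
    split_ifs with h
    · rw [Real.rpow_mul h.le, Real.rpow_two]
    · simp

end FourierRearrangement

/-! ### The main theorem -/

theorem mainTheorem6 (d : ℕ) (hd : 1 ≤ d) (β : ℝ) (hβ : (d : ℝ) / 2 ≤ β) :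
    -- the right-hand sides are well defined and real
    (∀ φ : EuclideanSpace ℝ (Fin d) → ℂ, Integrable φ →
      Integrable (FourierRearrangement.rearr φ) ∧
      (∀ ξ, (𝓕 (FourierRearrangement.rearr φ) ξ).im = 0) ∧
      ∀ Ω : ℝ, 0 < Ω →
        Integrable (fun ξ => FourierRearrangement.posPow (1 - ‖ξ‖ ^ 2 / Ω ^ 2) β *
          (𝓕 (FourierRearrangement.rearr φ) ξ).re)) ∧
    -- the Bochner-Riesz weights
    (∀ α : ℝ, -(1 / 2) < α →
      ∃ C : ℝ, 0 < C ∧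
        ∀ S Ω : ℝ, 0 < S → 0 < Ω →
        ∀ φ : EuclideanSpace ℝ (Fin d) → ℂ, Integrable φ →
          volume (Function.support φ) = ENNReal.ofReal S →
        ∀ a : EuclideanSpace ℝ (Fin d),
          Integrable (fun ξ =>
            ‖𝓕 φ ξ‖ * FourierRearrangement.posPow (1 - ‖ξ - a‖ ^ 2 / Ω ^ 2) α) ∧
          (Ω ^ d)⁻¹ * ∫ ξ,
              ‖𝓕 φ ξ‖ * FourierRearrangement.posPow (1 - ‖ξ - a‖ ^ 2 / Ω ^ 2) α
            ≤ C * (1 + Ω ^ d * S) ^ ((d : ℝ) / 2) *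
              ∫ ξ, (Ω ^ d)⁻¹ * (FourierRearrangement.posPow (1 - ‖ξ‖ ^ 2 / Ω ^ 2) β *
                (𝓕 (FourierRearrangement.rearr φ) ξ).re)) ∧
    -- general weights
    (∃ C : ℝ, 0 < C ∧
      ∀ ψ : EuclideanSpace ℝ (Fin d) → ℂ, MemLp ψ 1 → MemLp ψ 2 →
      ∀ S Ω : ℝ, 0 < S → 0 < Ω →
      ∀ φ : EuclideanSpace ℝ (Fin d) → ℂ, Integrable φ →
        volume (Function.support φ) = ENNReal.ofReal S →
        Integrable (fun ξ => ‖𝓕 φ ξ‖ * ‖ψ (Ω⁻¹ • ξ)‖) ∧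
        ∫ ξ, ‖𝓕 φ ξ‖ * ‖ψ (Ω⁻¹ • ξ)‖
          ≤ C * ((eLpNorm ψ 1).toReal ^ (2 / (d : ℝ)) +
                (eLpNorm ψ 2).toReal ^ (2 / (d : ℝ))) ^ ((d : ℝ) / 2) *
              (1 + Ω ^ d * S) ^ ((d : ℝ) / 2) *
            ∫ ξ, FourierRearrangement.posPow (1 - ‖ξ‖ ^ 2 / Ω ^ 2) β *
              (𝓕 (FourierRearrangement.rearr φ) ξ).re) := by
  have hβ1 : -1 < β := by
    have := (Nat.cast_nonneg d : (0 : ℝ) ≤ d)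
    linarith
  have hd0 : (0 : ℝ) < d := by exact_mod_cast hd
  obtain ⟨C, hC, hmain⟩ := FourierRearrangement.exists_integral_fourier_mul_le hd hβ
  refine ⟨fun φ hφ => ⟨FourierRearrangement.integrable_rearr hd hφ,
    FourierRearrangement.fourier_rearr_im φ, fun Ω hΩ =>
      FourierRearrangement.integrable_weight_mul_fourier_rearr hd hφ
        (FourierRearrangement.integrable_posPow_div hd hβ1 hΩ)⟩, fun α hα => ?_, ?_⟩
  · obtain ⟨hw1, hw2⟩ := FourierRearrangement.memLp_posPow hd hα
    set w : EuclideanSpace ℝ (Fin d) → ℂ :=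
      fun ξ => (FourierRearrangement.posPow (1 - ‖ξ‖ ^ 2) α : ℂ) with hw
    -- The added `1` keeps the constant `C * M` positive.
    set M := (eLpNorm w 1).toReal + (eLpNorm w 2).toReal + 1 with hM
    have hM0 : 0 < M := by positivity
    have hM1 : eLpNorm w 1 ≤ ENNReal.ofReal M := by
      rw [← ENNReal.ofReal_toReal hw1.2.ne]
      refine ENNReal.ofReal_le_ofReal ?_
      rw [hM, add_assoc]
      exact le_add_of_nonneg_right (by positivity)
    have hM2 : eLpNorm w 2 ≤ ENNReal.ofReal M := by
      rw [← ENNReal.ofReal_toReal hw2.2.ne]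
      refine ENNReal.ofReal_le_ofReal ?_
      rw [hM, add_assoc, add_left_comm]
      exact le_add_of_nonneg_right (by positivity)
    refine ⟨C * M, by positivity, fun S Ω hS hΩ φ hφ hsupp a => ?_⟩
    -- Translating the weight preserves both norms, so the constant does not depend on `a`.
    have hmp := measurePreserving_sub_right (volume : Measure (EuclideanSpace ℝ (Fin d))) (Ω⁻¹ • a)
    obtain ⟨hint, hle⟩ := hmain (fun η => w (η - Ω⁻¹ • a))
      (hw1.1.comp_measurePreserving hmp) M hM0.le
      ((eLpNorm_comp_measurePreserving hw1.1 hmp).trans_le hM1)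
      ((eLpNorm_comp_measurePreserving hw1.1 hmp).trans_le hM2) S Ω hS hΩ φ hφ hsupp
    have hwa : ∀ ξ, ‖w (Ω⁻¹ • ξ - Ω⁻¹ • a)‖ =
        FourierRearrangement.posPow (1 - ‖ξ - a‖ ^ 2 / Ω ^ 2) α := fun ξ => by
      rw [hw, ← smul_sub, Complex.norm_real, FourierRearrangement.one_sub_norm_inv_smul_sq hΩ,
        Real.norm_of_nonneg (FourierRearrangement.posPow_nonneg _ _)]
    simp only [hwa] at hint hle
    refine ⟨hint, ?_⟩
    rw [integral_const_mul, mul_left_comm]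
    exact mul_le_mul_of_nonneg_left hle (by positivity)
  · refine ⟨C, hC, fun ψ hψ1 hψ2 S Ω hS hΩ φ hφ hsupp => ?_⟩
    -- Each norm is at most the `ℓ^{2/d}`-type combination in the statement, which can therefore
    -- play the role of `M`.
    have hle : ∀ x y : ℝ, 0 ≤ x → 0 ≤ y →
        x ≤ (x ^ (2 / (d : ℝ)) + y ^ (2 / (d : ℝ))) ^ ((d : ℝ) / 2) := fun x y hx hy => by
      have h1 : (x ^ (2 / (d : ℝ))) ^ ((d : ℝ) / 2) = x := by
        rw [← Real.rpow_mul hx, div_mul_div_cancel₀ hd0.ne', div_self two_ne_zero, Real.rpow_one]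
      calc x = (x ^ (2 / (d : ℝ))) ^ ((d : ℝ) / 2) := h1.symm
        _ ≤ _ := Real.rpow_le_rpow (Real.rpow_nonneg hx _)
          (le_add_of_nonneg_right (Real.rpow_nonneg hy _)) (by positivity)
    have h1 := hle _ _ (ENNReal.toReal_nonneg (a := eLpNorm ψ 1))
      (ENNReal.toReal_nonneg (a := eLpNorm ψ 2))
    have h2 := hle _ _ (ENNReal.toReal_nonneg (a := eLpNorm ψ 2))
      (ENNReal.toReal_nonneg (a := eLpNorm ψ 1))
    rw [add_comm] at h2
    exact hmain ψ hψ1.1 _ (ENNReal.toReal_nonneg.trans h1)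
      ((ENNReal.ofReal_toReal hψ1.2.ne).symm.trans_le (ENNReal.ofReal_le_ofReal h1))
      ((ENNReal.ofReal_toReal hψ2.2.ne).symm.trans_le (ENNReal.ofReal_le_ofReal h2))
      S Ω hS hΩ φ hφ hsupp
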